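/- Let $Q$ be a smooth (Hausdorff) $n$-dimensional manifold, let $L\in C^\infty(TQ\times\mathbb R)$, and let $Y$ be a smooth vector field along the projection $Q\times\mathbb R\to Q$ (equivalently, a connection $\nabla$ in $Q\times\mathbb R\to\mathbb R$), with suspension $\widetilde Y=\partial_t+Y$. In natural coordinates $(q^\mu,v^\mu,t)$, with $Y=\Gamma^\mu(q,t)\,\partial_{q^\mu}$, let $$j^1\widetilde Y=\partial_t+\Gamma^\mu\,\partial_{q^\mu}+\Big(\frac{\partial\Gamma^\mu}{\partial t}+v^\nu\frac{\partial\Gamma^\mu}{\partial q^\nu}\Big)\partial_{v^\mu}$$ be its canonical lift to $TQ\times\mathbb R$. Let $\mathcal V=(dq^\mu-v^\mu dt)\otimes\partial_{v^\mu}$ be the vertical endomorphism and put $$\Theta_L=dL\circ\mathcal V+L\,dt,\qquad \Omega_L=-d\Theta_L,$$ $$\Theta_L^V=\Theta_L-\big(i(j^1\widetilde Y)\Theta_L\big)\,dt,\qquad \Omega_L^V=\Omega_L-dt\wedge i(j^1\widetilde Y)\Omega_L,\qquad E_L^\nabla=-i(j^1\widetilde Y)\Theta_L .$$ Assume that $j^1\widetilde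 Y$ is an infinitesimal symmetry of $L$, i.e. $(j^1\widetilde Y)L=0$. Let $[TQ\times\mathbb R]$ be the quotient of $TQ\times\mathbb R$, with the quotient topology, by the equivalence relation whose classes are the orbits (maximal integral curves) of $j^1\widetilde Y$, and assume that it is equipped with a smooth manifold structure for which the canonical projection $\overline\pi^1:TQ\times\mathbb R\to[TQ\times\mathbb R]$ is a smooth submersion. Then $\Theta_L^V$, $\Omega_L^V$ and $E_L^\nabla$ are $\overline\pi^1$-projectable: there exist a smooth $1$-form $\theta$, a smooth $2$-form $\omega$ and a smooth function $\mathcal E$ on $[TQ\times\mathbb R]$ such that $$(\overline\pi^1)^*\theta=\Theta_L^V,\qquad (\overline\pi^1)^*\omega=\Omega_L^V,\qquad \mathcal E\circ\overline\pi^1=E_L^\nabla .$$ -/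

import Mathlib

open scoped Manifold ContDiff

noncomputable section

/-! ## Differential forms on manifolds

A `k`-form on a manifold `M` is a field `α` of continuous alternating maps on its tangent spaces.
The exterior derivative is normalised by `dα (X, Y) = X (α Y) - Y (α X) - α [X, Y]` and the wedge
product by `(α ∧ β) (X, Y) = α X * β Y - α Y * β X`. -/

namespace MForm

variable {E : Type*} [NormedAddCommGroup E] [NormedSpace ℝ E]
  {H : Type*} [TopologicalSpace H] (I : ModelWithCorners ℝ E H)
  {M : Type*} [TopologicalSpace M] [ChartedSpace H M]
  {E' : Type*} [NormedAddCommGroup E'] [NormedSpace ℝ E']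
  {H' : Type*} [TopologicalSpace H'] (I' : ModelWithCorners ℝ E' H')
  {M' : Type*} [TopologicalSpace M'] [ChartedSpace H' M']
  {k : ℕ}

/-- The expression of the form `α` in the chart at `x₀`: the pull-back of `α` by the inverse of
that chart. It is meaningful on `(extChartAt I x₀).target`. -/
def inChart (α : ∀ x : M, TangentSpace I x [⋀^Fin k]→L[ℝ] ℝ) (x₀ : M) (y : E) :
    E [⋀^Fin k]→L[ℝ] ℝ :=
  (α ((extChartAt I x₀).symm y)).compContinuousLinearMap
    (mfderivWithin 𝓘(ℝ, E) I (extChartAt I x₀).symm (Set.range I) y)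

/-- A form is smooth if its expressions in charts are smooth. -/
def Smooth (α : ∀ x : M, TangentSpace I x [⋀^Fin k]→L[ℝ] ℝ) : Prop :=
  ∀ x₀ : M, ContDiffOn ℝ ∞ (inChart I α x₀) (extChartAt I x₀).target

/-- The exterior derivative, computed in charts. -/
def extDer (α : ∀ x : M, TangentSpace I x [⋀^Fin k]→L[ℝ] ℝ) (x : M) :
    TangentSpace I x [⋀^Fin (k + 1)]→L[ℝ] ℝ :=
  (extDerivWithin (inChart I α x) (Set.range I) (extChartAt I x x)).compContinuousLinearMap
    (mfderiv I 𝓘(ℝ, E) (extChartAt I x) x)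

/-- The pull-back of a form by a map. -/
def pullback (f : M → M') (β : ∀ y : M', TangentSpace I' y [⋀^Fin k]→L[ℝ] ℝ) (x : M) :
    TangentSpace I x [⋀^Fin k]→L[ℝ] ℝ :=
  (β (f x)).compContinuousLinearMap (mfderiv I I' f x)

/-- A form `α` on `M` is `f`-projectable if it is the pull-back `f^* β` of a smooth form `β`. -/
def Projectable (f : M → M') (α : ∀ x : M, TangentSpace I x [⋀^Fin k]→L[ℝ] ℝ) : Prop :=
  ∃ β : ∀ y : M', TangentSpace I' y [⋀^Fin k]→L[ℝ] ℝ, Smooth I' β ∧ pullback I I' f β = α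

/-- A covector at a point, as an alternating `1`-form. -/
def ofCovector {x : M} (a : TangentSpace I x →L[ℝ] ℝ) : TangentSpace I x [⋀^Fin 1]→L[ℝ] ℝ :=
  ContinuousAlternatingMap.ofSubsingleton ℝ (TangentSpace I x) ℝ (0 : Fin 1) a

/-- The wedge product `a ∧ b` of a covector and an alternating `k`-form. -/
def wedge {x : M} (a : TangentSpace I x →L[ℝ] ℝ) (b : TangentSpace I x [⋀^Fin k]→L[ℝ] ℝ) :
    TangentSpace I x [⋀^Fin (k + 1)]→L[ℝ] ℝ :=
  ContinuousAlternatingMap.alternatizeUncurryFin (E := E)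
    (ContinuousLinearMap.smulRight (M₁ := E) (M₂ := E [⋀^Fin k]→L[ℝ] ℝ) a b)

/-- The contraction `i(v) b = b (v, ·, …, ·)`. -/
def contract {x : M} (v : TangentSpace I x) (b : TangentSpace I x [⋀^Fin (k + 1)]→L[ℝ] ℝ) :
    TangentSpace I x [⋀^Fin k]→L[ℝ] ℝ :=
  ContinuousAlternatingMap.curryLeft (E := E) b v

end MForm

/-! ## Time-dependent Lagrangian systems -/

namespace Lagr

variable {n : ℕ} {Q : Type*} [TopologicalSpace Q] [ChartedSpace (EuclideanSpace ℝ (Fin n)) Q]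
  [IsManifold (𝓡 n) ∞ Q]

/-- The model with corners of the evolution phase space `TQ × ℝ`. -/
abbrev phaseModel (n : ℕ) := (𝓡 n).tangent.prod 𝓘(ℝ, ℝ)

variable (n Q) in
/-- The evolution phase space `TQ × ℝ`, i.e. the bundle of `1`-jets of sections of `Q × ℝ → ℝ`. -/
abbrev Phase := TangentBundle (𝓡 n) Q × ℝ

/-- The `1`-form `dt` on `TQ × ℝ`. -/
def dt (x : Phase n Q) : TangentSpace (phaseModel n) x →L[ℝ] ℝ :=
  mfderiv (phaseModel n) 𝓘(ℝ, ℝ) (fun y : Phase n Q => y.2) x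

/-- The differential of a function on `TQ × ℝ`. -/
def differential (f : Phase n Q → ℝ) (x : Phase n Q) : TangentSpace (phaseModel n) x →L[ℝ] ℝ :=
  mfderiv (phaseModel n) 𝓘(ℝ, ℝ) f x

/-- The structure form `ϑ = (dq - v dt) ⊗ ∂/∂q`, with values in `T_q Q`. -/
def structureForm (x : Phase n Q) :
    TangentSpace (phaseModel n) x →L[ℝ] TangentSpace (𝓡 n) x.1.proj :=
  mfderiv (phaseModel n) (𝓡 n) (fun y : Phase n Q => y.1.proj) x
    - (dt x).smulRight x.1.2

/-- The vertical lift `𝒮 : T_q Q → T_{(v_q, t)} (TQ × ℝ)`: the derivative at `v_q` of the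
inclusion of the fibre `T_q Q × {t}`. -/
def vertLift (x : Phase n Q) :
    TangentSpace (𝓡 n) x.1.proj →L[ℝ] TangentSpace (phaseModel n) x :=
  mfderiv 𝓘(ℝ, EuclideanSpace ℝ (Fin n)) (phaseModel n)
    (fun w : EuclideanSpace ℝ (Fin n) => ((⟨x.1.proj, w⟩, x.2) : Phase n Q)) x.1.2

/-- The vertical endomorphism `𝒱 = (dq - v dt) ⊗ ∂/∂v`. -/
def vertEndo (x : Phase n Q) :
    TangentSpace (phaseModel n) x →L[ℝ] TangentSpace (phaseModel n) x :=
  (vertLift x).comp (structureForm x)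

/-- The Poincaré–Cartan `1`-form `Θ_L = dL ∘ 𝒱 + L dt`. -/
def Theta (L : Phase n Q → ℝ) (x : Phase n Q) : TangentSpace (phaseModel n) x [⋀^Fin 1]→L[ℝ] ℝ :=
  MForm.ofCovector (phaseModel n) ((differential L x).comp (vertEndo x) + L x • dt x)

/-- The Poincaré–Cartan `2`-form `Ω_L = -dΘ_L`. -/
def Omega (L : Phase n Q → ℝ) (x : Phase n Q) : TangentSpace (phaseModel n) x [⋀^Fin 2]→L[ℝ] ℝ :=
  -MForm.extDer (phaseModel n) (Theta L) x

/-- A time-dependent vector field on `Q`, i.e. a vector field along `Q × ℝ → Q`, is smooth. -/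
def SmoothAlong (Y : ∀ z : Q × ℝ, TangentSpace (𝓡 n) z.1) : Prop :=
  ContMDiff ((𝓡 n).prod 𝓘(ℝ, ℝ)) (𝓡 n).tangent ∞
    (fun z : Q × ℝ => (⟨z.1, Y z⟩ : TangentBundle (𝓡 n) Q))

/-- The components `Γ(q, t)` of a vector field along `Q × ℝ → Q` in the chart of `Q` at `q₀`, as a
function of the coordinates `(q, t)`. -/
def components (Y : ∀ z : Q × ℝ, TangentSpace (𝓡 n) z.1) (q₀ : Q)
    (z : EuclideanSpace ℝ (Fin n) × ℝ) : EuclideanSpace ℝ (Fin n) :=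
  mfderiv (𝓡 n) 𝓘(ℝ, EuclideanSpace ℝ (Fin n)) (extChartAt (𝓡 n) q₀)
    ((extChartAt (𝓡 n) q₀).symm z.1) (Y ((extChartAt (𝓡 n) q₀).symm z.1, z.2))

/-- The canonical lift (`1`-jet prolongation) `j¹Ỹ` to `TQ × ℝ` of the suspension `Ỹ = ∂/∂t + Y`:
in natural coordinates `((q, v), t)`, it is
`∂/∂t + Γ ∂/∂q + (∂Γ/∂t + v ∂Γ/∂q) ∂/∂v`. -/
def jetLift (Y : ∀ z : Q × ℝ, TangentSpace (𝓡 n) z.1) (x : Phase n Q) :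
    TangentSpace (phaseModel n) x :=
  let z := extChartAt (phaseModel n) x x
  let Γ := components Y x.1.proj
  mfderivWithin 𝓘(ℝ, (EuclideanSpace ℝ (Fin n) × EuclideanSpace ℝ (Fin n)) × ℝ) (phaseModel n)
    (extChartAt (phaseModel n) x).symm (Set.range (phaseModel n)) z
    ((Γ (z.1.1, z.2), fderiv ℝ Γ (z.1.1, z.2) (z.1.2, 1)), (1 : ℝ))

/-- `j¹Ỹ` is an infinitesimal symmetry of `L`: the derivative of `L` along `j¹Ỹ` vanishes. -/
def IsInfSymmetry (L : Phase n Q → ℝ) (Y : ∀ z : Q × ℝ, TangentSpace (𝓡 n) z.1) : Prop :=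
  ∀ x : Phase n Q, differential L x (jetLift Y x) = 0

/-- The horizontal part `Θ_L^H = (i(j¹Ỹ) Θ_L) dt`. -/
def ThetaH (L : Phase n Q → ℝ) (Y : ∀ z : Q × ℝ, TangentSpace (𝓡 n) z.1) (x : Phase n Q) :
    TangentSpace (phaseModel n) x [⋀^Fin 1]→L[ℝ] ℝ :=
  MForm.wedge (phaseModel n) (dt x) (MForm.contract (phaseModel n) (jetLift Y x) (Theta L x))

/-- The vertical part `Θ_L^V = Θ_L - Θ_L^H`. -/
def ThetaV (L : Phase n Q → ℝ) (Y : ∀ z : Q × ℝ, TangentSpace (𝓡 n) z.1) (x : Phase n Q) :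
    TangentSpace (phaseModel n) x [⋀^Fin 1]→L[ℝ] ℝ :=
  Theta L x - ThetaH L Y x

/-- The horizontal part `Ω_L^H = dt ∧ i(j¹Ỹ) Ω_L`. -/
def OmegaH (L : Phase n Q → ℝ) (Y : ∀ z : Q × ℝ, TangentSpace (𝓡 n) z.1) (x : Phase n Q) :
    TangentSpace (phaseModel n) x [⋀^Fin 2]→L[ℝ] ℝ :=
  MForm.wedge (phaseModel n) (dt x) (MForm.contract (phaseModel n) (jetLift Y x) (Omega L x))

/-- The vertical part `Ω_L^V = Ω_L - Ω_L^H`. -/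
def OmegaV (L : Phase n Q → ℝ) (Y : ∀ z : Q × ℝ, TangentSpace (𝓡 n) z.1) (x : Phase n Q) :
    TangentSpace (phaseModel n) x [⋀^Fin 2]→L[ℝ] ℝ :=
  Omega L x - OmegaH L Y x

/-- The Lagrangian energy `E_L^∇ = -i(j¹Ỹ) Θ_L` of the connection given by `Y`. -/
def energy (L : Phase n Q → ℝ) (Y : ∀ z : Q × ℝ, TangentSpace (𝓡 n) z.1) (x : Phase n Q) : ℝ :=
  -Theta L x (fun _ => jetLift Y x)

/-- Two points lie on a common integral curve of `j¹Ỹ`, defined on an open interval. -/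
def OnCommonCurve (Y : ∀ z : Q × ℝ, TangentSpace (𝓡 n) z.1) (x y : Phase n Q) : Prop :=
  ∃ (γ : ℝ → Phase n Q) (J : Set ℝ), IsOpen J ∧ J.OrdConnected ∧
    IsMIntegralCurveOn (I := phaseModel n) γ (jetLift Y) J ∧ ∃ a ∈ J, ∃ b ∈ J, γ a = x ∧ γ b = y

/-- The equivalence relation whose classes are the orbits of `j¹Ỹ`. -/
def orbitSetoid (Y : ∀ z : Q × ℝ, TangentSpace (𝓡 n) z.1) : Setoid (Phase n Q) :=
  Relation.EqvGen.setoid (OnCommonCurve Y)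

/-- The quotient `[TQ × ℝ] = (TQ × ℝ) / j¹Ỹ`, with the quotient topology. -/
abbrev Reduced (Y : ∀ z : Q × ℝ, TangentSpace (𝓡 n) z.1) := Quotient (orbitSetoid Y)

/-- The canonical projection `TQ × ℝ → [TQ × ℝ]`. -/
def proj (Y : ∀ z : Q × ℝ, TangentSpace (𝓡 n) z.1) (x : Phase n Q) : Reduced Y :=
  Quotient.mk (orbitSetoid Y) x

end Lagr

end

/-!
The one-form `Θ_L^V` is basic for the projection `π : TQ × ℝ → [TQ × ℝ]`, and everything else
follows from it.

Write `X = j¹Ỹ`. Since `X` projects to `Y` on `Q` and `dt (X) = 1`, the form `Θ_L^V` is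
`dL ∘ 𝒮 ∘ (dq - Y dt)` with the vertical lift `𝒮` (`Lagr.ThetaV_apply`), so `i(X) Θ_L^V = 0`. In
natural coordinates `Θ_L^V = (∂L/∂v) (dq - Γ dt)`. The derivative of `X L = 0` in the fibre
directions (`Lagr.sndDeriv_prolong`) yields `i(X) dΘ_L^V = 0` (`Lagr.extDer_ThetaV_jetLift`) and
`X E_L^∇ = 0` (`Lagr.differential_energy_jetLift`). From `Θ_L = Θ_L^V - E_L^∇ dt` and these two
identities it follows that `Ω_L^V = -dΘ_L^V` (`Lagr.OmegaV_eq`).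

The field `X` is the same in all natural charts, because second derivatives are symmetric
(`Lagr.jetLift_extChartAt_symm`); it is therefore smooth, and as `TQ × ℝ` is Hausdorff its integral
curves are unique and can be glued. Hence each orbit is a single integral curve
(`Lagr.eq_or_onCommonCurve`), it is connected, and `t` is injective on it. As `π` is a submersion,
its fibres are locally copies of a complement of the model space; a continuous injection of that
complement into `ℝ` forces its dimension to be at most one (`rank_le_one_of_continuous_injective`),
so the kernel of `dπ` is spanned by `X` (`SubmersionCharts.exists_smul_eq`).

A one-form annihilated by `i(k)` and `i(k) d` for all `k` in the kernel of `dπ` is, in adapted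
coordinates, constant along the fibres; since the fibres are connected, it is the pull-back of a
form on the quotient, smooth because `π` has smooth local sections (`MForm.projectable_of_basic`).
This gives `θ`; then `ω = -dθ` by naturality of the exterior derivative (`MForm.extDer_pullback`),
and `E_L^∇` descends because it is constant along integral curves.
-/

open scoped Topology
open Set

noncomputable section

/-! ### Exterior derivative and pull-backs in charts -/

namespace MForm

section Naturality

variable {E : Type*} [NormedAddCommGroup E] [NormedSpace ℝ E]
  {H : Type*} [TopologicalSpace H] {I : ModelWithCorners ℝ E H}
  {M : Type*} [TopologicalSpace M] [ChartedSpace H M]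
  {E' : Type*} [NormedAddCommGroup E'] [NormedSpace ℝ E']
  {H' : Type*} [TopologicalSpace H'] {I' : ModelWithCorners ℝ E' H'}
  {M' : Type*} [TopologicalSpace M'] [ChartedSpace H' M']
  {E'' : Type*} [NormedAddCommGroup E''] [NormedSpace ℝ E'']
  {H'' : Type*} [TopologicalSpace H''] {I'' : ModelWithCorners ℝ E'' H''}
  {M'' : Type*} [TopologicalSpace M''] [ChartedSpace H'' M'']
  {k : ℕ}

theorem pullback_congr {f g : M → M'} {x : M} (h : f =ᶠ[𝓝 x] g)
    (β : ∀ y : M', TangentSpace I' y [⋀^Fin k]→L[ℝ] ℝ) :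
    pullback I I' f β x = pullback I I' g β x := by
  ext v
  let b : M' → E' [⋀^Fin k]→L[ℝ] ℝ := β
  let A : E →L[ℝ] E' := mfderiv I I' f x
  let B : E →L[ℝ] E' := mfderiv I I' g x
  have hAB : A = B := h.mfderiv_eq
  change b (f x) (fun i => A (v i)) = b (g x) (fun i => B (v i))
  rw [hAB, h.eq_of_nhds]

theorem pullback_comp {f : M → M'} {g : M' → M''} {x : M}
    (hg : MDifferentiableAt I' I'' g (f x)) (hf : MDifferentiableAt I I' f x)
    (β : ∀ y : M'', TangentSpace I'' y [⋀^Fin k]→L[ℝ] ℝ) :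
    pullback I I'' (g ∘ f) β x = pullback I I' f (pullback I' I'' g β) x := by
  ext v
  simp only [pullback, mfderiv_comp x hg hf]
  rfl

theorem inChart_eq_pullback [I.Boundaryless]
    (α : ∀ x : M, TangentSpace I x [⋀^Fin k]→L[ℝ] ℝ) (x₀ : M) :
    inChart I α x₀ = pullback 𝓘(ℝ, E) I (extChartAt I x₀).symm α := by
  funext y
  simp only [inChart, pullback, I.range_eq_univ, mfderivWithin_univ]
  rfl

theorem contMDiffAt_extChartAt_symm [I.Boundaryless] [IsManifold I ∞ M] {x₀ : M} {y : E}
    (hy : y ∈ (extChartAt I x₀).target) :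
    ContMDiffAt 𝓘(ℝ, E) I ∞ (extChartAt I x₀).symm y :=
  (contMDiffOn_extChartAt_symm x₀).contMDiffAt ((isOpen_extChartAt_target x₀).mem_nhds hy)

/-- The expression of `f^* β` in charts is the pull-back of the expression of `β` by the
expression of `f`. -/
theorem inChart_pullback [I.Boundaryless] [I'.Boundaryless] [IsManifold I ∞ M] [IsManifold I' ∞ M']
    {f : M → M'} (β : ∀ y : M', TangentSpace I' y [⋀^Fin k]→L[ℝ] ℝ) {x₀ : M} {y₀ : M'} {y : E}
    (hy : y ∈ (extChartAt I x₀).target)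
    (hf : MDifferentiableAt I I' f ((extChartAt I x₀).symm y))
    (hfy : f ((extChartAt I x₀).symm y) ∈ (extChartAt I' y₀).source) :
    inChart I (pullback I I' f β) x₀ y =
      (inChart I' β y₀ ((extChartAt I' y₀ ∘ f ∘ (extChartAt I x₀).symm) y)).compContinuousLinearMap
        (fderiv ℝ (extChartAt I' y₀ ∘ f ∘ (extChartAt I x₀).symm) y) := by
  have h1 := (contMDiffAt_extChartAt_symm (I := I) hy).mdifferentiableAt (by simp)
  have h2 : MDifferentiableAt 𝓘(ℝ, E) I' (f ∘ (extChartAt I x₀).symm) y := hf.comp y h1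
  have h3 : MDifferentiableAt 𝓘(ℝ, E) 𝓘(ℝ, E')
      (extChartAt I' y₀ ∘ f ∘ (extChartAt I x₀).symm) y :=
    ((contMDiffAt_extChartAt' (I := I') (n := ∞) (by simpa using hfy)).mdifferentiableAt
      (by simp)).comp y h2
  have h4 : (extChartAt I' y₀).symm ∘ (extChartAt I' y₀ ∘ f ∘ (extChartAt I x₀).symm) =ᶠ[𝓝 y]
      f ∘ (extChartAt I x₀).symm := by
    filter_upwards [h2.continuousAt.preimage_mem_nhds
      ((isOpen_extChartAt_source (I := I') y₀).mem_nhds hfy)] with z hz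
    exact (extChartAt I' y₀).left_inv hz
  have h5 := (contMDiffAt_extChartAt_symm (I := I')
    ((extChartAt I' y₀).map_source hfy)).mdifferentiableAt (by simp)
  rw [inChart_eq_pullback, inChart_eq_pullback]
  refine (pullback_comp hf h1 β).symm.trans ((pullback_congr h4 β).symm.trans
    ((pullback_comp (f := extChartAt I' y₀ ∘ f ∘ (extChartAt I x₀).symm)
      (g := (extChartAt I' y₀).symm) h5 h3 β).trans ?_))
  rw [pullback, mfderiv_eq_fderiv]
  rfl

/-- On a normed space, a form is its own expression in the only chart. -/
theorem inChart_self (η : ∀ x : E, TangentSpace 𝓘(ℝ, E) x [⋀^Fin k]→L[ℝ] ℝ) (x₀ : E) :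
    inChart 𝓘(ℝ, E) η x₀ = η := by
  rw [inChart_eq_pullback]
  funext y
  have : ((extChartAt 𝓘(ℝ, E) x₀).symm : E → E) = id := by
    simp only [extChartAt_model_space_eq_id]
    rfl
  rw [this]
  ext v
  simp only [pullback, mfderiv_id]
  rfl

theorem extDer_self (η : ∀ x : E, TangentSpace 𝓘(ℝ, E) x [⋀^Fin k]→L[ℝ] ℝ) (x : E) :
    extDer 𝓘(ℝ, E) η x = extDeriv (F := ℝ) (E := E) η x := by
  ext v
  simp only [extDer, inChart_self, mfderiv_extChartAt_self, modelWithCornersSelf_coe, range_id,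
    extChartAt_model_space_eq_id]
  exact congrArg (fun a : E [⋀^Fin (k + 1)]→L[ℝ] ℝ => a v)
    (congrFun (extDerivWithin_univ (E := E) (F := ℝ) η) x)

/-- At the centre of a chart, the derivative of the chart is the identity, so that no pull-back
remains in the coordinate expression of the exterior derivative. -/
theorem extDer_eq_extDeriv_inChart [I.Boundaryless] [IsManifold I ∞ M]
    (α : ∀ x : M, TangentSpace I x [⋀^Fin k]→L[ℝ] ℝ) (x : M) :
    extDer I α x = extDeriv (inChart I α x) (extChartAt I x x) := by
  have : IsManifold I 1 M := .of_le (n := ∞) (by simp)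
  simp only [extDer, mfderiv_extChartAt_self]
  ext v
  simp [I.range_eq_univ, extDerivWithin_univ]
  rfl

/-- The exterior derivative commutes with pull-backs. -/
theorem extDer_pullback [I.Boundaryless] [I'.Boundaryless] [IsManifold I ∞ M] [IsManifold I' ∞ M']
    {f : M → M'} {β : ∀ y : M', TangentSpace I' y [⋀^Fin k]→L[ℝ] ℝ} (hβ : Smooth I' β) {x : M}
    (hf : ContMDiffAt I I' ∞ f x) :
    extDer I (pullback I I' f β) x = pullback I I' f (extDer I' β) x := by
  have : IsManifold I 1 M := .of_le (n := ∞) (by simp)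
  have : IsManifold I' 1 M' := .of_le (n := ∞) (by simp)
  have hf2 : ContMDiffAt I I' 2 f x := hf.of_le (ENat.LEInfty.out)
  set F := extChartAt I' (f x) ∘ f ∘ (extChartAt I x).symm with hF
  have hFd : ContDiffAt ℝ 2 F (extChartAt I x x) := by
    have := (contMDiffAt_iff.1 hf2).2
    rwa [I.range_eq_univ, contDiffWithinAt_univ] at this
  have hev : ∀ᶠ z in 𝓝 x, MDifferentiableAt I I' f z ∧ f z ∈ (extChartAt I' (f x)).source := by
    refine (((contMDiffAt_iff_contMDiffAt_nhds (by simp)).1 hf2).mono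
      fun z hz => hz.mdifferentiableAt (by simp)).and ?_
    exact hf.continuousAt.preimage_mem_nhds (extChartAt_source_mem_nhds (I := I') (f x))
  have hcs : Filter.Tendsto (extChartAt I x).symm (𝓝 (extChartAt I x x)) (𝓝 x) := by
    have := (contMDiffAt_extChartAt_symm (I := I) (mem_extChartAt_target x)).continuousAt
    rwa [ContinuousAt, extChartAt_to_inv] at this
  have hloc : inChart I (pullback I I' f β) x =ᶠ[𝓝 (extChartAt I x x)]
      fun y => (inChart I' β (f x) (F y)).compContinuousLinearMap (fderiv ℝ F y) := by
    filter_upwards [hcs.eventually hev, extChartAt_target_mem_nhds (I := I) x] with y hy hyt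
    exact inChart_pullback β hyt hy.1 hy.2
  have hFx : F (extChartAt I x x) = extChartAt I' (f x) (f x) := by simp [hF]
  rw [extDer_eq_extDeriv_inChart, hloc.extDeriv_eq, extDeriv_pullback (r := 2) _ hFd (by simp)]
  · have hfF : (fderiv ℝ F (extChartAt I x x) : E →L[ℝ] E') = mfderiv I I' f x := by
      rw [(hf.mdifferentiableAt (by simp)).mfderiv, I.range_eq_univ]
      change _ = fderivWithin ℝ F univ _
      rw [fderivWithin_univ]
    rw [hfF, hFx]
    simp only [pullback]
    rw [extDer_eq_extDeriv_inChart]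
    rfl
  · rw [hFx]
    exact ((hβ (f x)).contDiffAt (extChartAt_target_mem_nhds (I := I') (f x))).differentiableAt
      (by simp)

theorem inChart_extDer [I.Boundaryless] [IsManifold I ∞ M]
    {β : ∀ y : M, TangentSpace I y [⋀^Fin k]→L[ℝ] ℝ} (hβ : Smooth I β) {x₀ : M} {y : E}
    (hy : y ∈ (extChartAt I x₀).target) :
    inChart I (extDer I β) x₀ y = extDeriv (inChart I β x₀) y := by
  rw [inChart_eq_pullback, ← extDer_pullback hβ (contMDiffAt_extChartAt_symm hy), extDer_self,
    inChart_eq_pullback]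

theorem Smooth.extDer [I.Boundaryless] [IsManifold I ∞ M]
    {β : ∀ y : M, TangentSpace I y [⋀^Fin k]→L[ℝ] ℝ} (hβ : Smooth I β) :
    Smooth I (extDer I β) := by
  intro x₀
  have h : ContDiffOn ℝ ∞ (fderiv ℝ (inChart I β x₀)) (extChartAt I x₀).target :=
    (hβ x₀).fderiv_of_isOpen (isOpen_extChartAt_target x₀) (by simp)
  refine ((ContinuousAlternatingMap.alternatizeUncurryFinCLM ℝ E ℝ).contDiff.comp_contDiffOn
    h).congr fun y hy => ?_
  rw [inChart_extDer hβ hy]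
  rfl

theorem Smooth.neg {β : ∀ y : M, TangentSpace I y [⋀^Fin k]→L[ℝ] ℝ} (hβ : Smooth I β) :
    Smooth I (fun y => -β y) := by
  intro x₀
  exact (hβ x₀).neg.congr fun y _ => rfl

end Naturality

end MForm

/-! ### Submersions in adapted coordinates -/

section Submersion

variable {E : Type*} [NormedAddCommGroup E] [NormedSpace ℝ E]
  {H : Type*} [TopologicalSpace H] {I : ModelWithCorners ℝ E H}
  {M : Type*} [TopologicalSpace M] [ChartedSpace H M]
  {E' : Type*} [NormedAddCommGroup E'] [NormedSpace ℝ E']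
  {H' : Type*} [TopologicalSpace H'] {I' : ModelWithCorners ℝ E' H'}
  {N : Type*} [TopologicalSpace N] [ChartedSpace H' N]
  {K : Type*} [NormedAddCommGroup K] [NormedSpace ℝ K]

variable (I I' K) in
/-- Smooth coordinates near `x` and `f x` in which `f` is the projection `E' × K → E'`. They are
plain partial equivalences, with the smoothness as separate fields, because the coordinates with
values in the product `E' × K` are not charts of `M`. -/
structure SubmersionCharts (f : M → N) (x : M) where
  /-- The coordinates near `x`. -/
  dom : PartialEquiv M (E' × K)
  /-- The coordinates near `f x`. -/
  cod : PartialEquiv N E'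
  mem_source : x ∈ dom.source
  isOpen_source : IsOpen dom.source
  isOpen_target : IsOpen dom.target
  contMDiffOn : ContMDiffOn I 𝓘(ℝ, E' × K) ∞ dom dom.source
  contMDiffOn_symm : ContMDiffOn 𝓘(ℝ, E' × K) I ∞ dom.symm dom.target
  isOpen_cod_source : IsOpen cod.source
  isOpen_cod_target : IsOpen cod.target
  contMDiffOn_cod : ContMDiffOn I' 𝓘(ℝ, E') ∞ cod cod.source
  contMDiffOn_cod_symm : ContMDiffOn 𝓘(ℝ, E') I' ∞ cod.symm cod.target
  mapsTo : MapsTo f dom.source cod.source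
  cod_apply : ∀ y ∈ dom.source, cod (f y) = (dom y).1

theorem Manifold.IsSubmersionAtOfComplement.nonempty_submersionCharts [I.Boundaryless]
    [I'.Boundaryless] {f : M → N} {x : M} (h : IsSubmersionAtOfComplement K I I' ∞ f x) :
    Nonempty (SubmersionCharts I I' K f x) := by
  refine ⟨
    { dom := (h.domChart.extend I).transEquiv h.equiv.toEquiv
      cod := h.codChart.extend I'
      mem_source := by simpa using h.mem_domChart_source
      isOpen_source := by simpa using h.domChart.open_source
      isOpen_target := h.domChart.isOpen_extend_target.preimage h.equiv.symm.continuous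
      contMDiffOn := ?_
      contMDiffOn_symm := ?_
      isOpen_cod_source := by simpa using h.codChart.open_source
      isOpen_cod_target := h.codChart.isOpen_extend_target
      contMDiffOn_cod := by
        rw [OpenPartialHomeomorph.extend_source]
        exact h.codChart.contMDiffOn_extend h.codChart_mem_maximalAtlas
      contMDiffOn_cod_symm := by
        rw [OpenPartialHomeomorph.extend_target']
        exact contMDiffOn_extend_symm h.codChart_mem_maximalAtlas
      mapsTo := by
        intro y hy
        simpa using h.source_subset_preimage_source (by simpa using hy)
      cod_apply := ?_ }⟩
  · have h1 := h.domChart.contMDiffOn_extend h.domChart_mem_maximalAtlas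
    rw [← OpenPartialHomeomorph.extend_source (I := I)] at h1
    exact h.equiv.contDiff.contMDiff.comp_contMDiffOn h1
  · have h1 := contMDiffOn_extend_symm h.domChart_mem_maximalAtlas
    rw [← OpenPartialHomeomorph.extend_target'] at h1
    exact h1.comp h.equiv.symm.contDiff.contMDiff.contMDiffOn fun y hy => hy
  · intro y hy
    have h1 := h.writtenInCharts ((h.domChart.extend I).map_source hy)
    simp only [Function.comp_apply, (h.domChart.extend I).left_inv hy] at h1
    exact h1

namespace SubmersionCharts

variable {f : M → N} {x : M} (c : SubmersionCharts I I' K f x)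

theorem apply_symm {u : E' × K} (hu : u ∈ c.dom.target) : f (c.dom.symm u) = c.cod.symm u.1 := by
  rw [← c.cod.left_inv (c.mapsTo (c.dom.map_target hu)), c.cod_apply _ (c.dom.map_target hu),
    c.dom.right_inv hu]

theorem fst_mem_target {u : E' × K} (hu : u ∈ c.dom.target) : u.1 ∈ c.cod.target := by
  have := c.cod.map_source (c.mapsTo (c.dom.map_target hu))
  rwa [c.cod_apply _ (c.dom.map_target hu), c.dom.right_inv hu] at this

theorem contMDiffAt_dom {y : M} (hy : y ∈ c.dom.source) :
    ContMDiffAt I 𝓘(ℝ, E' × K) ∞ c.dom y :=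
  c.contMDiffOn.contMDiffAt (c.isOpen_source.mem_nhds hy)

theorem contMDiffAt_symm {u : E' × K} (hu : u ∈ c.dom.target) :
    ContMDiffAt 𝓘(ℝ, E' × K) I ∞ c.dom.symm u :=
  c.contMDiffOn_symm.contMDiffAt (c.isOpen_target.mem_nhds hu)

theorem contMDiffAt_cod_symm {u : E'} (hu : u ∈ c.cod.target) :
    ContMDiffAt 𝓘(ℝ, E') I' ∞ c.cod.symm u :=
  c.contMDiffOn_cod_symm.contMDiffAt (c.isOpen_cod_target.mem_nhds hu)

theorem contMDiffAt_map {y : M} (hy : y ∈ c.dom.source) : ContMDiffAt I I' ∞ f y := by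
  have h1 : ContMDiffAt I 𝓘(ℝ, E') ∞ (fun z => (c.dom z).1) y :=
    contDiff_fst.contMDiff.contMDiffAt.comp y (c.contMDiffAt_dom hy)
  have h2 : ContMDiffAt 𝓘(ℝ, E') I' ∞ c.cod.symm (c.dom y).1 := by
    refine c.contMDiffAt_cod_symm ?_
    exact c.fst_mem_target (c.dom.map_source hy)
  refine (h2.comp y h1).congr_of_eventuallyEq ?_
  filter_upwards [c.isOpen_source.mem_nhds hy] with z hz
  rw [Function.comp_apply, ← c.cod_apply z hz, c.cod.left_inv (c.mapsTo hz)]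

/-- A submersion has smooth local sections through every point. -/
theorem exists_section (c : SubmersionCharts I I' K f x) :
    ∃ (O : Set N) (σ : N → M), IsOpen O ∧ f x ∈ O ∧ ContMDiffOn I' I ∞ σ O ∧
      (∀ y ∈ O, f (σ y) = y) ∧ σ (f x) = x := by
  let g : N → E' × K := fun y => (c.cod y, (c.dom x).2)
  have hg : ContMDiffOn I' 𝓘(ℝ, E' × K) ∞ g c.cod.source :=
    c.contMDiffOn_cod.prodMk_space contMDiffOn_const
  have hgx : g (f x) = c.dom x := Prod.ext (c.cod_apply x c.mem_source) rfl
  refine ⟨c.cod.source ∩ g ⁻¹' c.dom.target, c.dom.symm ∘ g,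
    hg.continuousOn.isOpen_inter_preimage c.isOpen_cod_source c.isOpen_target,
    ⟨c.mapsTo c.mem_source, ?_⟩, c.contMDiffOn_symm.comp (hg.mono inter_subset_left)
      inter_subset_right, ?_, ?_⟩
  · rw [mem_preimage, hgx]
    exact c.dom.map_source c.mem_source
  · rintro y ⟨hy1, hy2⟩
    rw [Function.comp_apply, c.apply_symm hy2, c.cod.left_inv hy1]
  · rw [Function.comp_apply, hgx, c.dom.left_inv c.mem_source]

theorem mfderiv_map_mfderiv_symm {u : E' × K} (hu : u ∈ c.dom.target) (w : E' × K) :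
    (mfderiv I I' f (c.dom.symm u) (mfderiv 𝓘(ℝ, E' × K) I c.dom.symm u w) : E') =
      mfderiv 𝓘(ℝ, E') I' c.cod.symm u.1 w.1 := by
  have h1 : f ∘ c.dom.symm =ᶠ[𝓝 u] c.cod.symm ∘ Prod.fst := by
    filter_upwards [c.isOpen_target.mem_nhds hu] with z hz
    exact c.apply_symm hz
  have h2 := h1.mfderiv_eq (I := 𝓘(ℝ, E' × K)) (I' := I')
  have hs := (c.contMDiffAt_symm hu).mdifferentiableAt (by simp)
  have hc := (c.contMDiffAt_cod_symm (c.fst_mem_target hu)).mdifferentiableAt (by simp)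
  have hf := (c.contMDiffAt_map (c.dom.map_target hu)).mdifferentiableAt (by simp)
  have hfst : MDifferentiableAt 𝓘(ℝ, E' × K) 𝓘(ℝ, E') (Prod.fst : E' × K → E') u :=
    differentiableAt_fst.mdifferentiableAt
  rw [mfderiv_comp u hf hs, mfderiv_comp u hc hfst] at h2
  have h3 := congrArg (fun A : E' × K →L[ℝ] E' => A w) h2
  refine h3.trans ?_
  have h4 : (mfderiv 𝓘(ℝ, E' × K) 𝓘(ℝ, E') (Prod.fst : E' × K → E') u : E' × K →L[ℝ] E') =
      ContinuousLinearMap.fst ℝ E' K := by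
    rw [mfderiv_eq_fderiv]
    exact fderiv_fst
  exact congrArg (fun A : E' × K →L[ℝ] E' =>
    (mfderiv 𝓘(ℝ, E') I' c.cod.symm u.1 : E' →L[ℝ] E') (A w)) h4

theorem mfderiv_symm_surjective {u : E' × K} (hu : u ∈ c.dom.target)
    (w : TangentSpace I (c.dom.symm u)) :
    ∃ v : E' × K, mfderiv 𝓘(ℝ, E' × K) I c.dom.symm u v = w := by
  have hx := c.dom.map_target hu
  have hs := (c.contMDiffAt_symm hu).mdifferentiableAt (by simp)
  rw [← c.dom.right_inv hu] at hs
  have hd := (c.contMDiffAt_dom hx).mdifferentiableAt (by simp)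
  have h1 : c.dom.symm ∘ c.dom =ᶠ[𝓝 (c.dom.symm u)] id := by
    filter_upwards [c.isOpen_source.mem_nhds hx] with z hz
    exact c.dom.left_inv hz
  have h2 := h1.mfderiv_eq (I := I) (I' := I)
  rw [mfderiv_comp _ hs hd, mfderiv_id] at h2
  have h3 := congrArg (fun A : E →L[ℝ] E => A w) h2
  refine ⟨mfderiv I 𝓘(ℝ, E' × K) c.dom (c.dom.symm u) w, ?_⟩
  have h4 : (mfderiv 𝓘(ℝ, E' × K) I c.dom.symm u : E' × K →L[ℝ] E) =
      mfderiv 𝓘(ℝ, E' × K) I c.dom.symm (c.dom (c.dom.symm u)) := by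
    rw [c.dom.right_inv hu]
  exact (congrArg (fun A : E' × K →L[ℝ] E =>
    A (mfderiv I 𝓘(ℝ, E' × K) c.dom (c.dom.symm u) w)) h4).trans h3

theorem mfderiv_cod_symm_injective {u : E'} (hu : u ∈ c.cod.target) {v : E'}
    (hv : (mfderiv 𝓘(ℝ, E') I' c.cod.symm u v : E') = 0) : v = 0 := by
  have hs := (c.contMDiffAt_cod_symm hu).mdifferentiableAt (by simp)
  have hd := (c.contMDiffOn_cod.contMDiffAt (c.isOpen_cod_source.mem_nhds
    (c.cod.map_target hu))).mdifferentiableAt (by simp)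
  have h1 : c.cod ∘ c.cod.symm =ᶠ[𝓝 u] id := by
    filter_upwards [c.isOpen_cod_target.mem_nhds hu] with z hz
    exact c.cod.right_inv hz
  have h2 := h1.mfderiv_eq (I := 𝓘(ℝ, E')) (I' := 𝓘(ℝ, E'))
  rw [mfderiv_comp _ hd hs, mfderiv_id] at h2
  have h3 := congrArg (fun A : E' →L[ℝ] E' => A v) h2
  refine h3.symm.trans ?_
  exact (congrArg (mfderiv I' 𝓘(ℝ, E') c.cod (c.cod.symm u) : E' →L[ℝ] E') hv).trans
    (map_zero (mfderiv I' 𝓘(ℝ, E') c.cod (c.cod.symm u) : E' →L[ℝ] E'))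

theorem exists_rightInverse (c : SubmersionCharts I I' K f x) :
    ∃ R : E' →L[ℝ] E, ∀ v : E', (mfderiv I I' f x : E →L[ℝ] E') (R v) = v := by
  have hfx := c.mapsTo c.mem_source
  have hd := (c.contMDiffOn_cod.contMDiffAt (c.isOpen_cod_source.mem_nhds
    hfx)).mdifferentiableAt (by simp)
  have hs := (c.contMDiffAt_cod_symm (c.cod.map_source hfx)).mdifferentiableAt (by simp)
  have h1 : c.cod.symm ∘ c.cod =ᶠ[𝓝 (f x)] id := by
    filter_upwards [c.isOpen_cod_source.mem_nhds hfx] with z hz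
    exact c.cod.left_inv hz
  have h2 := h1.mfderiv_eq (I := I') (I' := I')
  rw [mfderiv_comp _ hs hd, mfderiv_id] at h2
  let A : E' →L[ℝ] E' := mfderiv I' 𝓘(ℝ, E') c.cod (f x)
  let B : E' × K →L[ℝ] E := mfderiv 𝓘(ℝ, E' × K) I c.dom.symm (c.dom x)
  refine ⟨B.comp ((ContinuousLinearMap.inl ℝ E' K).comp A), fun v => ?_⟩
  have h3 := c.mfderiv_map_mfderiv_symm (c.dom.map_source c.mem_source) (A v, 0)
  rw [c.dom.left_inv c.mem_source, ← c.cod_apply x c.mem_source] at h3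
  exact h3.trans (congrArg (fun L : E' →L[ℝ] E' => L v) h2)

end SubmersionCharts

/-- A normed space that injects continuously into the real line has dimension at most one:
a line in it is mapped monotonically, and deleting a point of the line would disconnect the image
but not the space. -/
theorem rank_le_one_of_continuous_injective {g : K → ℝ} (hg : Continuous g)
    (hi : Function.Injective g) : Module.rank ℝ K ≤ 1 := by
  by_contra! h
  have : Nontrivial K := by
    by_contra hn
    rw [not_nontrivial_iff_subsingleton] at hn
    rw [rank_subsingleton'] at h
    simp at h
  obtain ⟨v, hv⟩ := exists_ne (0 : K)
  have hline : Function.Injective fun s : ℝ => g (s • v) := fun s t hst =>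
    smul_left_injective ℝ hv (hi hst)
  have hcont : Continuous fun s : ℝ => g (s • v) := by fun_prop
  have hpre : ((g '' {(0 : K)}ᶜ)).OrdConnected :=
    ((isConnected_compl_singleton_of_one_lt_rank h 0).isPreconnected.image g
      hg.continuousOn).ordConnected
  have hmem : ∀ s : ℝ, s ≠ 0 → g (s • v) ∈ g '' {(0 : K)}ᶜ := fun s hs =>
    ⟨s • v, by simp [hs, hv], rfl⟩
  have key : g ((0 : ℝ) • v) ∈ g '' {(0 : K)}ᶜ := by
    rcases hcont.strictMono_of_inj hline with hm | hm
    · exact hpre.out (hmem (-1) (by norm_num)) (hmem 1 (by norm_num))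
        ⟨(hm (by norm_num : (-1 : ℝ) < 0)).le, (hm (by norm_num : (0 : ℝ) < 1)).le⟩
    · exact hpre.out (hmem 1 (by norm_num)) (hmem (-1) (by norm_num))
        ⟨(hm (by norm_num : (0 : ℝ) < 1)).le, (hm (by norm_num : (-1 : ℝ) < 0)).le⟩
  obtain ⟨w, hw, hw'⟩ := key
  rw [zero_smul] at hw'
  exact hw (hi hw')

/-- If a continuous real function is injective on the fibre of a submersion, the kernel of the
differential of the submersion is at most one-dimensional. -/
theorem SubmersionCharts.exists_smul_eq {f : M → N} {x : M} (c : SubmersionCharts I I' K f x)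
    {τ : M → ℝ} (hτ : Continuous τ) (hinj : ∀ y z, f y = f z → τ y = τ z → y = z)
    {k k' : TangentSpace I x} (hk : (mfderiv I I' f x k : E') = 0)
    (hk' : (mfderiv I I' f x k' : E') = 0) (hk0 : k ≠ 0) : ∃ r : ℝ, k' = r • k := by
  have hu := c.dom.map_source c.mem_source
  -- A full copy of `K`, reparametrised as a ball, lies in one fibre of `f`, so that `τ` injects it
  -- into the real line.
  obtain ⟨r, hr, hball⟩ : ∃ r > 0, ∀ z ∈ Metric.ball (c.dom x).2 r,
      ((c.dom x).1, z) ∈ c.dom.target := by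
    have hc : Continuous fun z : K => ((c.dom x).1, z) := by fun_prop
    exact Metric.mem_nhds_iff.1 ((c.isOpen_target.preimage hc).mem_nhds hu)
  let B := OpenPartialHomeomorph.univBall (c.dom x).2 r
  have hB : ∀ z : K, ((c.dom x).1, B z) ∈ c.dom.target := fun z => by
    refine hball _ ?_
    rw [← OpenPartialHomeomorph.univBall_target (c.dom x).2 hr]
    exact B.map_source (by simp [B])
  have hBc : Continuous B := OpenPartialHomeomorph.continuous_univBall _ _
  have hBi : Function.Injective B := by
    have := B.injOn
    rwa [show B.source = univ by simp [B], injOn_univ] at this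
  have hrank : Module.rank ℝ K ≤ 1 := by
    refine rank_le_one_of_continuous_injective
      (g := fun z => τ (c.dom.symm ((c.dom x).1, B z))) ?_ ?_
    · refine hτ.comp ?_
      exact c.contMDiffOn_symm.continuousOn.comp_continuous (by fun_prop) hB
    · intro z z' hzz
      have h1 := hinj _ _ ((c.apply_symm (hB z)).trans (c.apply_symm (hB z')).symm) hzz
      have h2 := c.dom.symm.injOn (hB z) (hB z') h1
      exact hBi (congrArg Prod.snd h2)
  obtain ⟨v₀, hv₀⟩ := rank_le_one_iff.1 hrank
  have hxe : c.dom.symm (c.dom x) = x := c.dom.left_inv c.mem_source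
  -- Every vector of the kernel is the image of a vector of the factor `K`.
  obtain ⟨A, hlift⟩ : ∃ A : E' × K →L[ℝ] E, ∀ w : E, (mfderiv I I' f x : E →L[ℝ] E') w = 0 →
      ∃ z : K, A (0, z) = w := by
    refine ⟨mfderiv 𝓘(ℝ, E' × K) I c.dom.symm (c.dom x), fun w hw => ?_⟩
    obtain ⟨v, hv⟩ := c.mfderiv_symm_surjective hu w
    have h1 := c.mfderiv_map_mfderiv_symm hu v
    rw [hv, hxe] at h1
    have h2 := c.mfderiv_cod_symm_injective (c.fst_mem_target hu) (h1.symm.trans hw)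
    refine ⟨v.2, ?_⟩
    rw [← hv, ← h2]
    rfl
  obtain ⟨z, hz⟩ := hlift k hk
  obtain ⟨z', hz'⟩ := hlift k' hk'
  obtain ⟨s, rfl⟩ := hv₀ z
  obtain ⟨s', rfl⟩ := hv₀ z'
  have hlin : ∀ a : ℝ, A (0, a • v₀) = a • A (0, v₀) := fun a => by
    rw [← ContinuousLinearMap.map_smul, Prod.smul_mk, smul_zero]
  rw [hlin] at hz hz'
  have hs : s ≠ 0 := by
    rintro rfl
    exact hk0 (hz.symm.trans (zero_smul ℝ _))
  refine ⟨s' / s, hz'.symm.trans (Eq.trans ?_ (congrArg (fun e : E => (s' / s) • e) hz))⟩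
  rw [smul_smul, div_mul_cancel₀ _ hs]

end Submersion

/-! ### Descent of functions and forms along submersions -/

theorem Fin.removeNth_zero_pair {V : Type*} (a b : V) :
    (0 : Fin 2).removeNth ![a, b] = fun _ : Fin 1 => b := by
  funext i
  rw [Subsingleton.elim i 0]
  rfl

theorem Fin.removeNth_one_pair {V : Type*} (a b : V) :
    (1 : Fin 2).removeNth ![a, b] = fun _ : Fin 1 => a := by
  funext i
  rw [Subsingleton.elim i 0]
  rfl

section Descent

variable {E : Type*} [NormedAddCommGroup E] [NormedSpace ℝ E]
  {H : Type*} [TopologicalSpace H] {I : ModelWithCorners ℝ E H}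
  {M : Type*} [TopologicalSpace M] [ChartedSpace H M]
  {E' : Type*} [NormedAddCommGroup E'] [NormedSpace ℝ E']
  {H' : Type*} [TopologicalSpace H'] {I' : ModelWithCorners ℝ E' H'}
  {N : Type*} [TopologicalSpace N] [ChartedSpace H' N]
  {K : Type*} [NormedAddCommGroup K] [NormedSpace ℝ K]

/-- The pull-back of a covector by a linear map depends smoothly on both. -/
theorem ContDiffAt.compContinuousLinearMap_form {V : Type*} [NormedAddCommGroup V]
    [NormedSpace ℝ V] {g : V → E' [⋀^Fin 1]→L[ℝ] ℝ} {A : V → E →L[ℝ] E'} {y : V} {n : ℕ∞ω}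
    (hg : ContDiffAt ℝ n g y) (hA : ContDiffAt ℝ n A y) :
    ContDiffAt ℝ n (fun z => (g z).compContinuousLinearMap (A z)) y := by
  let e := ContinuousAlternatingMap.ofSubsingletonLIE (𝕜 := ℝ) (E := E) (F := ℝ) (0 : Fin 1)
  let e' := ContinuousAlternatingMap.ofSubsingletonLIE (𝕜 := ℝ) (E := E') (F := ℝ) (0 : Fin 1)
  have h1 : ContDiffAt ℝ n (fun z => e'.symm (g z)) y :=
    e'.symm.contDiff.contDiffAt.comp y hg
  refine ((e.contDiff.contDiffAt (x := (e'.symm (g y)).comp (A y))).comp y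
    (h1.clm_comp hA)).congr_of_eventuallyEq (.of_forall fun z => ?_)
  ext v
  exact congrArg (g z) (funext fun i => congrArg (fun j => A z (v j)) (Subsingleton.elim i 0))

theorem MForm.contDiffAt_inChart_pullback [I.Boundaryless] [I'.Boundaryless] [IsManifold I ∞ M]
    [IsManifold I' ∞ N] {f : M → N} {β : ∀ y : N, TangentSpace I' y [⋀^Fin 1]→L[ℝ] ℝ}
    (hβ : Smooth I' β) {O : Set M} (hO : IsOpen O) (hf : ContMDiffOn I I' ∞ f O) {x₀ : M} {y : E}
    (hy : y ∈ (extChartAt I x₀).target) (hyO : (extChartAt I x₀).symm y ∈ O) :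
    ContDiffAt ℝ ∞ (inChart I (pullback I I' f β) x₀) y := by
  set p := f ((extChartAt I x₀).symm y) with hp
  set F := extChartAt I' p ∘ f ∘ (extChartAt I x₀).symm with hF
  have hs := contMDiffAt_extChartAt_symm (I := I) hy
  have hfy := hf.contMDiffAt (hO.mem_nhds hyO)
  have hFs : ContDiffAt ℝ ∞ F y := by
    have h1 : ContMDiffAt 𝓘(ℝ, E) 𝓘(ℝ, E') ∞ F y :=
      (contMDiffAt_extChartAt (I := I') (x := p)).comp y (hfy.comp y hs)
    exact h1.contDiffAt
  have hev : ∀ᶠ z in 𝓝 y, z ∈ (extChartAt I x₀).target ∧ (extChartAt I x₀).symm z ∈ O ∧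
      f ((extChartAt I x₀).symm z) ∈ (extChartAt I' p).source := by
    refine Filter.Eventually.and ((isOpen_extChartAt_target x₀).mem_nhds hy)
      ((hs.continuousAt.eventually (hO.mem_nhds hyO)).and ?_)
    exact (hfy.comp y hs).continuousAt.preimage_mem_nhds (extChartAt_source_mem_nhds (I := I') p)
  have hloc : inChart I (pullback I I' f β) x₀ =ᶠ[𝓝 y]
      fun z => (inChart I' β p (F z)).compContinuousLinearMap (fderiv ℝ F z) := by
    filter_upwards [hev] with z hz
    exact inChart_pullback β hz.1
      ((hf.contMDiffAt (hO.mem_nhds hz.2.1)).mdifferentiableAt (by simp)) hz.2.2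
  have hFy : F y = extChartAt I' p p := rfl
  have h1 : ContDiffAt ℝ ∞ (fun z => inChart I' β p (F z)) y := by
    refine ContDiffAt.comp (g := inChart I' β p) (f := F) y ?_ hFs
    rw [hFy]
    exact (hβ p).contDiffAt (extChartAt_target_mem_nhds (I := I') p)
  have h2 : ContDiffAt ℝ ∞ (fderiv ℝ F) y := hFs.fderiv_right (by simp)
  exact (h1.compContinuousLinearMap_form h2).congr_of_eventuallyEq hloc

/-- A smooth `1`-form pulled back to a normed space is a smooth function. -/
theorem MForm.contDiffAt_pullback [I'.Boundaryless] [IsManifold I' ∞ N]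
    {f : E → N} {β : ∀ y : N, TangentSpace I' y [⋀^Fin 1]→L[ℝ] ℝ}
    (hβ : Smooth I' β) {O : Set E} (hO : IsOpen O) (hf : ContMDiffOn 𝓘(ℝ, E) I' ∞ f O) {y : E}
    (hy : y ∈ O) :
    ContDiffAt (F := E [⋀^Fin 1]→L[ℝ] ℝ) ℝ ∞ (pullback 𝓘(ℝ, E) I' f β) y := by
  have := contDiffAt_inChart_pullback hβ hO hf (x₀ := y) (y := y)
    (mem_extChartAt_target y) (by rw [extChartAt_model_space_eq_id]; exact hy)
  rwa [inChart_self] at this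

/-- A function on the base of a surjective submersion is smooth if its lift is. -/
theorem contMDiff_of_comp_submersion {V : Type*} [NormedAddCommGroup V] [NormedSpace ℝ V]
    {f : M → N} (hf : ∀ x, Nonempty (SubmersionCharts I I' K f x)) (hsurj : Function.Surjective f)
    {e : N → V} (he : ContMDiff I 𝓘(ℝ, V) ∞ (e ∘ f)) : ContMDiff I' 𝓘(ℝ, V) ∞ e := by
  intro p
  obtain ⟨x, rfl⟩ := hsurj p
  obtain ⟨c⟩ := hf x
  obtain ⟨O, σ, hO, hxO, hσ, hfσ, -⟩ := c.exists_section
  have h1 : ContMDiffAt I' 𝓘(ℝ, V) ∞ ((e ∘ f) ∘ σ) (f x) :=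
    he.contMDiffAt.comp _ (hσ.contMDiffAt (hO.mem_nhds hxO))
  refine h1.congr_of_eventuallyEq ?_
  filter_upwards [hO.mem_nhds hxO] with y hy
  simp [hfσ y hy]

/-- A form on the base of a surjective submersion is smooth if its pull-back is. -/
theorem MForm.smooth_of_smooth_pullback [I.Boundaryless] [I'.Boundaryless] [IsManifold I ∞ M]
    [IsManifold I' ∞ N] {f : M → N} (hf : ∀ x, Nonempty (SubmersionCharts I I' K f x))
    (hsurj : Function.Surjective f) {β : ∀ y : N, TangentSpace I' y [⋀^Fin 1]→L[ℝ] ℝ}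
    (hβ : Smooth I (pullback I I' f β)) : Smooth I' β := by
  intro p₀ y hy
  obtain ⟨x, hx⟩ := hsurj ((extChartAt I' p₀).symm y)
  obtain ⟨c⟩ := hf x
  obtain ⟨O, σ, hO, hxO, hσ, hfσ, hσx⟩ := c.exists_section
  rw [hx] at hxO
  refine ((contDiffAt_inChart_pullback hβ hO hσ hy hxO).congr_of_eventuallyEq
    ?_).contDiffWithinAt
  filter_upwards [(isOpen_extChartAt_target p₀).mem_nhds hy,
    (contMDiffAt_extChartAt_symm (I := I') hy).continuousAt.eventually (hO.mem_nhds hxO)]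
    with z hz hzO
  have hid : f ∘ σ =ᶠ[𝓝 ((extChartAt I' p₀).symm z)] id := by
    filter_upwards [hO.mem_nhds hzO] with q hq
    exact hfσ q hq
  have hfd : MDifferentiableAt I I' f (σ ((extChartAt I' p₀).symm z)) := by
    obtain ⟨c'⟩ := hf (σ ((extChartAt I' p₀).symm z))
    exact (c'.contMDiffAt_map c'.mem_source).mdifferentiableAt (by simp)
  have h1 : pullback I' I σ (pullback I I' f β) ((extChartAt I' p₀).symm z) =
      β ((extChartAt I' p₀).symm z) := by
    rw [← pullback_comp hfd ((hσ.contMDiffAt (hO.mem_nhds hzO)).mdifferentiableAt (by simp)),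
      pullback_congr hid]
    ext v
    simp only [pullback, mfderiv_id]
    rfl
  simp only [inChart, h1]

/-- If a `1`-form vanishes on a constant vector `a` near `u` and `dγ (a, ·) = 0` at `u`, then its
derivative along `a` vanishes at `u`. -/
theorem fderiv_eq_zero_of_extDeriv {γ : E → E [⋀^Fin 1]→L[ℝ] ℝ} {u : E}
    (hγ : DifferentiableAt ℝ γ u) {a : E} (h0 : ∀ᶠ v in 𝓝 u, γ v (fun _ => a) = 0)
    (h : ∀ w, extDeriv γ u ![a, w] = 0) : fderiv ℝ γ u a = 0 := by
  ext m
  have h1 := h (m 0)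
  rw [extDeriv_apply hγ, Fin.sum_univ_two] at h1
  have e : m = fun _ => m 0 := funext fun i => congrArg m (Subsingleton.elim i 0)
  rw [Fin.removeNth_zero_pair, Fin.removeNth_one_pair, ← e] at h1
  have h2 : HasFDerivAt (fun v => γ v m)
      ((ContinuousAlternatingMap.apply ℝ E ℝ m).comp (fderiv ℝ γ u)) u :=
    (ContinuousAlternatingMap.apply ℝ E ℝ m).hasFDerivAt.comp u hγ.hasFDerivAt
  have h3 : fderiv ℝ (fun v => γ v (fun _ => a)) u = 0 := by
    rw [Filter.EventuallyEq.fderiv_eq (f := fun _ => (0 : ℝ)) h0]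
    simp
  rw [h2.fderiv, h3] at h1
  simpa using h1

/-- A `1`-form `α` such that `i(k) α = 0` and `i(k) dα = 0` for all vectors `k` tangent to the
fibres of a submersion is locally constant along the fibres: a covector that pulls back to `α` at a
point pulls back to `α` at all nearby points of the fibre. -/
theorem SubmersionCharts.eventually_pullback_iff [I.Boundaryless] [IsManifold I ∞ M]
    {f : M → N} {x : M} (c : SubmersionCharts I I' K f x)
    {α : ∀ y : M, TangentSpace I y [⋀^Fin 1]→L[ℝ] ℝ} (hα : MForm.Smooth I α)
    (h0 : ∀ (y : M) (a : TangentSpace I y), (mfderiv I I' f y a : E') = 0 → α y (fun _ => a) = 0)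
    (h1 : ∀ (y : M) (a b : TangentSpace I y), (mfderiv I I' f y a : E') = 0 →
      MForm.extDer I α y ![a, b] = 0) :
    ∀ᶠ y in 𝓝 x, f y = f x → ∀ b : E' →L[ℝ] ℝ,
      (∀ w : TangentSpace I x, α x (fun _ => w) = b (mfderiv I I' f x w)) ↔
      (∀ w : TangentSpace I y, α y (fun _ => w) = b (mfderiv I I' f y w)) := by
  -- In adapted coordinates the expression `γ` of the form has no component along `K`, and its
  -- derivative along `K` vanishes, so that it is constant on the slices `{u} × ball`.
  let γ : E' × K → (E' × K) [⋀^Fin 1]→L[ℝ] ℝ := MForm.pullback 𝓘(ℝ, E' × K) I c.dom.symm α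
  have hγ : ∀ u ∈ c.dom.target, DifferentiableAt ℝ γ u := fun u hu =>
    (MForm.contDiffAt_pullback hα c.isOpen_target c.contMDiffOn_symm hu).differentiableAt (by simp)
  have hvert : ∀ u ∈ c.dom.target, ∀ z : K, (mfderiv I I' f (c.dom.symm u)
      (mfderiv 𝓘(ℝ, E' × K) I c.dom.symm u ((0, z) : E' × K)) : E') = 0 := fun u hu z =>
    (c.mfderiv_map_mfderiv_symm hu (0, z)).trans
      (map_zero (mfderiv 𝓘(ℝ, E') I' c.cod.symm u.1 : E' →L[ℝ] E'))
  have hγ0 : ∀ u ∈ c.dom.target, ∀ z : K, γ u (fun _ => (0, z)) = 0 := fun u hu z =>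
    h0 _ _ (hvert u hu z)
  have hγ1 : ∀ u ∈ c.dom.target, ∀ (z : K) (w : E' × K), extDeriv γ u ![(0, z), w] = 0 := by
    intro u hu z w
    have e1 := MForm.extDer_pullback (I := 𝓘(ℝ, E' × K)) hα (c.contMDiffAt_symm hu)
    rw [MForm.extDer_self] at e1
    have e2 := congrArg (fun a : (E' × K) [⋀^Fin 2]→L[ℝ] ℝ => a ![(0, z), w]) e1
    refine e2.trans ?_
    refine (congrArg (MForm.extDer I α (c.dom.symm u)) ?_).trans
      (h1 _ _ (mfderiv 𝓘(ℝ, E' × K) I c.dom.symm u w) (hvert u hu z))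
    funext i
    fin_cases i <;> rfl
  have hγd : ∀ u ∈ c.dom.target, ∀ z : K, fderiv ℝ γ u (0, z) = 0 := fun u hu z =>
    fderiv_eq_zero_of_extDeriv (hγ u hu)
      (Filter.mem_of_superset (c.isOpen_target.mem_nhds hu) fun v hv => hγ0 v hv z)
      (hγ1 u hu z)
  -- The condition on `b` at a point only involves the coordinate expression `γ` at that point.
  have hiff : ∀ u ∈ c.dom.target, ∀ b : E' →L[ℝ] ℝ,
      (∀ w : TangentSpace I (c.dom.symm u),
        α (c.dom.symm u) (fun _ => w) = b (mfderiv I I' f (c.dom.symm u) w)) ↔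
      ∀ v : E' × K, γ u (fun _ => v) = b (mfderiv 𝓘(ℝ, E') I' c.cod.symm u.1 v.1) := by
    intro u hu b
    constructor
    · intro h v
      exact (h _).trans (congrArg b (c.mfderiv_map_mfderiv_symm hu v))
    · intro h w
      obtain ⟨v, rfl⟩ := c.mfderiv_symm_surjective hu w
      exact (h v).trans (congrArg b (c.mfderiv_map_mfderiv_symm hu v).symm)
  have hu := c.dom.map_source c.mem_source
  obtain ⟨r, hr, hball⟩ : ∃ r > 0, ∀ z ∈ Metric.ball (c.dom x).2 r,
      ((c.dom x).1, z) ∈ c.dom.target := by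
    have hc : Continuous fun z : K => ((c.dom x).1, z) := by fun_prop
    exact Metric.mem_nhds_iff.1 ((c.isOpen_target.preimage hc).mem_nhds hu)
  have hslice : ∀ z ∈ Metric.ball (c.dom x).2 r, HasFDerivAt (fun z => γ ((c.dom x).1, z))
      (0 : K →L[ℝ] ((E' × K) [⋀^Fin 1]→L[ℝ] ℝ)) z := by
    intro z hz
    have e1 : HasFDerivAt (fun z : K => ((c.dom x).1, z)) (ContinuousLinearMap.inr ℝ E' K) z :=
      hasFDerivAt_prodMk_right _ _
    have e2 := (hγ _ (hball z hz)).hasFDerivAt.comp z e1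
    have e3 : (fderiv ℝ γ ((c.dom x).1, z)).comp (ContinuousLinearMap.inr ℝ E' K) = 0 := by
      ext1 k
      exact hγd _ (hball z hz) k
    rwa [e3] at e2
  have hconst : ∀ z ∈ Metric.ball (c.dom x).2 r,
      γ ((c.dom x).1, z) = γ ((c.dom x).1, (c.dom x).2) := fun z hz =>
    Metric.isOpen_ball.is_const_of_fderiv_eq_zero (convex_ball _ _).isPreconnected
      (fun y hy => (hslice y hy).differentiableAt.differentiableWithinAt)
      (fun y hy => (hslice y hy).fderiv) hz (Metric.mem_ball_self hr)
  have hnear : ∀ᶠ y in 𝓝 x, (c.dom y).2 ∈ Metric.ball (c.dom x).2 r :=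
    (continuousAt_snd.comp (c.contMDiffAt_dom c.mem_source).continuousAt).preimage_mem_nhds
      (Metric.ball_mem_nhds _ hr)
  filter_upwards [hnear, c.isOpen_source.mem_nhds c.mem_source] with y hy hys hfy b
  have e1 : (c.dom y).1 = (c.dom x).1 := by
    rw [← c.cod_apply y hys, ← c.cod_apply x c.mem_source, hfy]
  have e2 : γ (c.dom y) = γ (c.dom x) := by
    rw [← Prod.mk.eta (p := c.dom y), e1]
    exact hconst _ hy
  have hx' := hiff (c.dom x) hu b
  have hy' := hiff (c.dom y) (c.dom.map_source hys) b
  rw [c.dom.left_inv c.mem_source] at hx'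
  rw [c.dom.left_inv hys] at hy'
  rw [hx', hy', e2, e1]

/-- A smooth `1`-form `α` with `i(k) α = 0` and `i(k) dα = 0` for all vectors `k` tangent to the
fibres of a surjective submersion with connected fibres is projectable. -/
theorem MForm.projectable_of_basic [I.Boundaryless] [I'.Boundaryless] [IsManifold I ∞ M]
    [IsManifold I' ∞ N] {f : M → N} (hf : ∀ x, Nonempty (SubmersionCharts I I' K f x))
    (hsurj : Function.Surjective f) (hconn : ∀ p, IsPreconnected (f ⁻¹' {p}))
    {α : ∀ y : M, TangentSpace I y [⋀^Fin 1]→L[ℝ] ℝ} (hα : Smooth I α)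
    (h0 : ∀ (y : M) (a : TangentSpace I y), (mfderiv I I' f y a : E') = 0 → α y (fun _ => a) = 0)
    (h1 : ∀ (y : M) (a b : TangentSpace I y), (mfderiv I I' f y a : E') = 0 →
      extDer I α y ![a, b] = 0) :
    Projectable I I' f α := by
  have hex : ∀ x : M, ∃ b : E' →L[ℝ] ℝ, ∀ w : TangentSpace I x,
      α x (fun _ => w) = b (mfderiv I I' f x w) := by
    intro x
    obtain ⟨c⟩ := hf x
    obtain ⟨R, hR⟩ := c.exists_rightInverse
    let a : E →L[ℝ] ℝ := (ContinuousAlternatingMap.ofSubsingleton ℝ E ℝ (0 : Fin 1)).symm (α x)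
    let A : E →L[ℝ] E' := mfderiv I I' f x
    have ha : ∀ w : E, a w = α x (fun _ => w) := fun w => rfl
    refine ⟨a.comp R, fun (w : E) => ?_⟩
    have h2 : a (w - R (A w)) = 0 := by
      rw [ha]
      refine h0 x _ ?_
      change A (w - R (A w)) = 0
      rw [map_sub, sub_eq_zero]
      exact (hR (A w)).symm
    rw [map_sub, sub_eq_zero] at h2
    exact h2
  choose b hb using hex
  choose g hg using hsurj
  let β : ∀ y : N, TangentSpace I' y [⋀^Fin 1]→L[ℝ] ℝ := fun y => ofCovector I' (b (g y))
  have hfib : ∀ x y : M, f x = f y → ∀ b : E' →L[ℝ] ℝ,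
      (∀ w : TangentSpace I x, α x (fun _ => w) = b (mfderiv I I' f x w)) ↔
      (∀ w : TangentSpace I y, α y (fun _ => w) = b (mfderiv I I' f y w)) := by
    intro x y hxy
    refine (hconn (f y)).induction₂ (fun x y => ∀ b : E' →L[ℝ] ℝ,
      (∀ w : TangentSpace I x, α x (fun _ => w) = b (mfderiv I I' f x w)) ↔
      (∀ w : TangentSpace I y, α y (fun _ => w) = b (mfderiv I I' f y w))) ?_ ?_ ?_ hxy rfl
    · intro z hz
      obtain ⟨c⟩ := hf z
      filter_upwards [mem_nhdsWithin_of_mem_nhds (c.eventually_pullback_iff hα h0 h1),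
        self_mem_nhdsWithin] with z' hz' hfz'
      exact hz' (hfz'.trans (Eq.symm hz))
    · intro z₁ z₂ z₃ _ _ _ e1 e2 b
      exact (e1 b).trans (e2 b)
    · intro z₁ z₂ _ _ e1 b
      exact (e1 b).symm
  have hpull : pullback I I' f β = α := by
    funext x
    ext v
    have e1 := (hfib (g (f x)) x (hg (f x)) (b (g (f x)))).1 (hb (g (f x))) (v 0)
    have e2 : v = fun _ => v 0 := funext fun i => congrArg v (Subsingleton.elim i 0)
    rw [e2]
    exact e1.symm
  refine ⟨β, ?_, hpull⟩
  refine smooth_of_smooth_pullback hf (fun y => ⟨g y, hg y⟩) ?_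
  rw [hpull]
  exact hα

end Descent

/-! ### Natural coordinates of the evolution phase space -/

namespace Lagr

variable {n : ℕ} {Q : Type*} [TopologicalSpace Q] [ChartedSpace (EuclideanSpace ℝ (Fin n)) Q]
  [IsManifold (𝓡 n) ∞ Q]

/-- The model space of the configuration manifold. -/
abbrev Config (n : ℕ) := EuclideanSpace ℝ (Fin n)

/-- The space of natural coordinates `((q, v), t)`. -/
abbrev PhaseCoords (n : ℕ) := (Config n × Config n) × ℝ

/-- The charts of `TQ × ℝ` are the natural charts: the velocity is read through the derivative of
the chart of `Q`. -/
theorem extChartAt_phase_apply {x₀ x : Phase n Q}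
    (h : x.1.proj ∈ (extChartAt (𝓡 n) x₀.1.proj).source) :
    extChartAt (phaseModel n) x₀ x = ((extChartAt (𝓡 n) x₀.1.proj x.1.proj,
      mfderiv (𝓡 n) 𝓘(ℝ, Config n) (extChartAt (𝓡 n) x₀.1.proj) x.1.proj x.1.2),
      x.2) := by
  have h' : x.1.proj ∈ (chartAt (Config n) x₀.1.proj).source := by simpa using h
  rw [← TangentBundle.continuousLinearMapAt_trivializationAt h',
    TangentBundle.continuousLinearMapAt_trivializationAt_eq_core h']
  rfl

theorem mem_extChartAt_phase_source {x₀ x : Phase n Q} :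
    x ∈ (extChartAt (phaseModel n) x₀).source ↔
      x.1.proj ∈ (extChartAt (𝓡 n) x₀.1.proj).source := by
  rw [extChartAt_prod, PartialEquiv.prod_source, extChartAt_source, extChartAt_source,
    extChartAt_source]
  exact (and_iff_left (mem_univ _)).trans (TangentBundle.mem_chart_source_iff _ _)

theorem mem_extChartAt_phase_target {x₀ : Phase n Q}
    {z : PhaseCoords n} :
    z ∈ (extChartAt (phaseModel n) x₀).target ↔ z.1.1 ∈ (extChartAt (𝓡 n) x₀.1.proj).target := by
  rw [extChartAt_prod, PartialEquiv.prod_target, extChartAt_target, extChartAt_target]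
  simp only [mfld_simps]
  refine (and_iff_left (mem_univ _)).trans ?_
  rw [Prod.map_id, range_id]
  refine (and_iff_left (mem_univ _)).trans ?_
  exact TangentBundle.mem_chart_target_iff (I := 𝓡 n) (M := Q) _ _

theorem extChartAt_phase_symm_apply {x₀ : Phase n Q}
    {z : PhaseCoords n}
    (hz : z ∈ (extChartAt (phaseModel n) x₀).target) :
    (extChartAt (phaseModel n) x₀).symm z =
      (⟨(extChartAt (𝓡 n) x₀.1.proj).symm z.1.1,
        mfderiv 𝓘(ℝ, Config n) (𝓡 n) (extChartAt (𝓡 n) x₀.1.proj).symm z.1.1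
          z.1.2⟩, z.2) := by
  have : IsManifold (𝓡 n) 1 Q := .of_le (n := ∞) (by simp)
  have hz' := mem_extChartAt_phase_target.1 hz
  refine (extChartAt (phaseModel n) x₀).injOn ((extChartAt (phaseModel n) x₀).map_target hz)
    (mem_extChartAt_phase_source.2 ((extChartAt (𝓡 n) x₀.1.proj).map_target hz')) ?_
  rw [(extChartAt (phaseModel n) x₀).right_inv hz,
    extChartAt_phase_apply ((extChartAt (𝓡 n) x₀.1.proj).map_target hz')]
  refine Prod.ext (Prod.ext ((extChartAt (𝓡 n) x₀.1.proj).right_inv hz').symm ?_) rfl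
  have h1 := mfderiv_extChartAt_comp_mfderivWithin_extChartAt_symm (I := 𝓡 n) hz'
  rw [(𝓡 n).range_eq_univ, mfderivWithin_univ] at h1
  exact (congrArg (fun A : Config n →L[ℝ] Config n => A z.1.2)
    h1).symm

section Coordinates

variable {x₀ : Phase n Q} {z : PhaseCoords n}

theorem mdifferentiableAt_extChartAt_phase_symm (hz : z ∈ (extChartAt (phaseModel n) x₀).target) :
    MDifferentiableAt 𝓘(ℝ, PhaseCoords n) (phaseModel n) (extChartAt (phaseModel n) x₀).symm z :=
  (MForm.contMDiffAt_extChartAt_symm hz).mdifferentiableAt (by simp)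

theorem mdifferentiableAt_extChartAt_config_symm
    (hz : z ∈ (extChartAt (phaseModel n) x₀).target) :
    MDifferentiableAt 𝓘(ℝ, Config n) (𝓡 n) (extChartAt (𝓡 n) x₀.1.proj).symm z.1.1 :=
  (MForm.contMDiffAt_extChartAt_symm (mem_extChartAt_phase_target.1 hz)).mdifferentiableAt
    (by simp)

theorem eventually_mem_target (hz : z ∈ (extChartAt (phaseModel n) x₀).target) :
    ∀ᶠ y in 𝓝 z, y ∈ (extChartAt (phaseModel n) x₀).target :=
  (isOpen_extChartAt_target x₀).mem_nhds hz

/-- The projection to `Q` in natural coordinates. -/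
theorem mfderiv_base_extChartAt_symm (hz : z ∈ (extChartAt (phaseModel n) x₀).target)
    (w : PhaseCoords n) :
    (mfderiv (phaseModel n) (𝓡 n) (fun y : Phase n Q => y.1.proj)
      ((extChartAt (phaseModel n) x₀).symm z) (mfderiv 𝓘(ℝ, PhaseCoords n) (phaseModel n)
        (extChartAt (phaseModel n) x₀).symm z w) : Config n) =
      mfderiv 𝓘(ℝ, Config n) (𝓡 n) (extChartAt (𝓡 n) x₀.1.proj).symm z.1.1 w.1.1 := by
  have h1 : (fun y : Phase n Q => y.1.proj) ∘ (extChartAt (phaseModel n) x₀).symm =ᶠ[𝓝 z]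
      (extChartAt (𝓡 n) x₀.1.proj).symm ∘ fun y : PhaseCoords n => y.1.1 := by
    filter_upwards [eventually_mem_target hz] with y hy
    simp only [Function.comp_apply, extChartAt_phase_symm_apply hy]
  have hp : MDifferentiableAt (phaseModel n) (𝓡 n) (fun y : Phase n Q => y.1.proj)
      ((extChartAt (phaseModel n) x₀).symm z) :=
    ((Bundle.contMDiff_proj (IB := 𝓡 n) (n := 1) (TangentSpace (𝓡 n) : Q → Type _)).comp
      (contMDiff_fst (I := (𝓡 n).tangent) (J := 𝓘(ℝ, ℝ)))).mdifferentiableAt (by simp)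
  have hpr : HasFDerivAt (fun y : PhaseCoords n => y.1.1)
      ((ContinuousLinearMap.fst ℝ (Config n) (Config n)).comp
        (ContinuousLinearMap.fst ℝ (Config n × Config n) ℝ)) z :=
    hasFDerivAt_fst.comp z hasFDerivAt_fst
  have h2 := h1.mfderiv_eq (I := 𝓘(ℝ, PhaseCoords n)) (I' := 𝓡 n)
  rw [mfderiv_comp z hp (mdifferentiableAt_extChartAt_phase_symm hz),
    mfderiv_comp z (mdifferentiableAt_extChartAt_config_symm hz)
      hpr.differentiableAt.mdifferentiableAt, mfderiv_eq_fderiv, hpr.fderiv] at h2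
  exact congrArg (fun A : PhaseCoords n →L[ℝ] Config n => A w) h2

theorem dt_extChartAt_symm (hz : z ∈ (extChartAt (phaseModel n) x₀).target) (w : PhaseCoords n) :
    dt ((extChartAt (phaseModel n) x₀).symm z) (mfderiv 𝓘(ℝ, PhaseCoords n) (phaseModel n)
      (extChartAt (phaseModel n) x₀).symm z w) = w.2 := by
  have h1 : (fun y : Phase n Q => y.2) ∘ (extChartAt (phaseModel n) x₀).symm =ᶠ[𝓝 z]
      fun y : PhaseCoords n => y.2 := by
    filter_upwards [eventually_mem_target hz] with y hy
    simp only [Function.comp_apply, extChartAt_phase_symm_apply hy]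
  have hp : MDifferentiableAt (phaseModel n) 𝓘(ℝ, ℝ) (fun y : Phase n Q => y.2)
      ((extChartAt (phaseModel n) x₀).symm z) := mdifferentiableAt_snd
  have h2 := h1.mfderiv_eq (I := 𝓘(ℝ, PhaseCoords n)) (I' := 𝓘(ℝ, ℝ))
  rw [mfderiv_comp z hp (mdifferentiableAt_extChartAt_phase_symm hz), mfderiv_eq_fderiv,
    fderiv_snd] at h2
  exact congrArg (fun A : PhaseCoords n →L[ℝ] ℝ => A w) h2

/-- The vertical lift in natural coordinates. -/
theorem vertLift_extChartAt_symm (hz : z ∈ (extChartAt (phaseModel n) x₀).target)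
    (u : Config n) :
    vertLift ((extChartAt (phaseModel n) x₀).symm z) u =
      mfderiv 𝓘(ℝ, PhaseCoords n) (phaseModel n) (extChartAt (phaseModel n) x₀).symm z
        ((0, mfderiv (𝓡 n) 𝓘(ℝ, Config n) (extChartAt (𝓡 n) x₀.1.proj)
          ((extChartAt (𝓡 n) x₀.1.proj).symm z.1.1) u), 0) := by
  set x := (extChartAt (phaseModel n) x₀).symm z with hx
  have hxs : x ∈ (extChartAt (phaseModel n) x₀).source := (extChartAt _ x₀).map_target hz
  have hxq := mem_extChartAt_phase_source.1 hxs
  have hzx : extChartAt (phaseModel n) x₀ x = z := (extChartAt _ x₀).right_inv hz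
  let A : Config n →L[ℝ] Config n :=
    mfderiv (𝓡 n) 𝓘(ℝ, Config n) (extChartAt (𝓡 n) x₀.1.proj) x.1.proj
  -- `g` is the inclusion of the fibre of `TQ` in natural coordinates; it is affine.
  let g : Config n → PhaseCoords n := fun w => ((z.1.1, A w), z.2)
  have hz1 : extChartAt (𝓡 n) x₀.1.proj x.1.proj = z.1.1 := by
    rw [← hzx, extChartAt_phase_apply hxq]
  have hz2 : x.2 = z.2 := by rw [← hzx, extChartAt_phase_apply hxq]
  have hgx : g x.1.2 = z := by
    rw [← hzx, extChartAt_phase_apply hxq]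
    simp only [g, A, hz1, hz2]
    rfl
  have hg : ∀ w : Config n, HasFDerivAt g ((ContinuousLinearMap.inl ℝ (Config n × Config n) ℝ).comp
      ((ContinuousLinearMap.inr ℝ (Config n) (Config n)).comp A)) w := fun w => by
    have h1 : HasFDerivAt (fun w => (z.1.1, A w))
        ((ContinuousLinearMap.inr ℝ (Config n) (Config n)).comp A) w :=
      (hasFDerivAt_prodMk_right z.1.1 (A w)).comp w A.hasFDerivAt
    exact (hasFDerivAt_prodMk_left (z.1.1, A w) z.2).comp w h1
  have h1 : (fun w : Config n => ((⟨x.1.proj, w⟩, x.2) : Phase n Q)) =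
      (extChartAt (phaseModel n) x₀).symm ∘ g := by
    funext w
    let y : Phase n Q := (⟨x.1.proj, w⟩, x.2)
    have hs : y ∈ (extChartAt (phaseModel n) x₀).source := mem_extChartAt_phase_source.2 hxq
    have hy : extChartAt (phaseModel n) x₀ y = g w :=
      (extChartAt_phase_apply (x := y) hxq).trans (Prod.ext (Prod.ext hz1 rfl) hz2)
    exact ((extChartAt (phaseModel n) x₀).left_inv hs).symm.trans (congrArg _ hy)
  let w₀ : Config n := x.1.2
  have hgx' : g w₀ = z := hgx
  have hs := mdifferentiableAt_extChartAt_phase_symm hz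
  rw [← hgx'] at hs
  have h2 := mfderiv_comp w₀ hs (hg w₀).differentiableAt.mdifferentiableAt
  rw [← h1, mfderiv_eq_fderiv, (hg w₀).fderiv, hgx'] at h2
  exact congrArg (fun B : Config n →L[ℝ] PhaseCoords n => B u) h2

theorem differential_extChartAt_symm {L : Phase n Q → ℝ}
    (hL : ContMDiff (phaseModel n) 𝓘(ℝ, ℝ) ∞ L) (hz : z ∈ (extChartAt (phaseModel n) x₀).target)
    (w : PhaseCoords n) :
    differential L ((extChartAt (phaseModel n) x₀).symm z) (mfderiv 𝓘(ℝ, PhaseCoords n)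
      (phaseModel n) (extChartAt (phaseModel n) x₀).symm z w) =
      fderiv ℝ (L ∘ (extChartAt (phaseModel n) x₀).symm) z w := by
  rw [← mfderiv_eq_fderiv, mfderiv_comp z (hL.mdifferentiableAt (by simp))
    (mdifferentiableAt_extChartAt_phase_symm hz)]
  rfl

end Coordinates

end Lagr

/-! ### The forms and the lift, pointwise -/

theorem MForm.wedge_apply {E : Type*} [NormedAddCommGroup E] [NormedSpace ℝ E]
    {H : Type*} [TopologicalSpace H] {I : ModelWithCorners ℝ E H}
    {M : Type*} [TopologicalSpace M] [ChartedSpace H M] {k : ℕ} {x : M}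
    (a : TangentSpace I x →L[ℝ] ℝ) (b : TangentSpace I x [⋀^Fin k]→L[ℝ] ℝ)
    (v : Fin (k + 1) → TangentSpace I x) :
    wedge I a b v = ∑ i : Fin (k + 1), (-1) ^ (i : ℕ) * (a (v i) * b (i.removeNth v)) := by
  refine (ContinuousAlternatingMap.alternatizeUncurryFin_apply (E := E) _ v).trans ?_
  refine Finset.sum_congr rfl fun i _ => ?_
  rw [zsmul_eq_mul]
  push_cast
  rfl

namespace Lagr

variable {n : ℕ} {Q : Type*} [TopologicalSpace Q] [ChartedSpace (EuclideanSpace ℝ (Fin n)) Q]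
  [IsManifold (𝓡 n) ∞ Q]

/-- The prolongation `∂/∂t + Γ ∂/∂q + (∂Γ/∂t + v ∂Γ/∂q) ∂/∂v` in natural coordinates. -/
def prolong (Γ : Config n × ℝ → Config n) (z : PhaseCoords n) : PhaseCoords n :=
  ((Γ (z.1.1, z.2), fderiv ℝ Γ (z.1.1, z.2) (z.1.2, 1)), 1)

theorem jetLift_eq (Y : ∀ z : Q × ℝ, TangentSpace (𝓡 n) z.1) (x : Phase n Q) :
    jetLift Y x = mfderiv 𝓘(ℝ, PhaseCoords n) (phaseModel n) (extChartAt (phaseModel n) x).symm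
      (extChartAt (phaseModel n) x x)
      (prolong (components Y x.1.proj) (extChartAt (phaseModel n) x x)) := by
  rw [jetLift, (phaseModel n).range_eq_univ, mfderivWithin_univ]
  rfl

/-- `components Y q₀` are the components of `Y` with respect to the coordinate frame. -/
theorem mfderiv_symm_components (Y : ∀ z : Q × ℝ, TangentSpace (𝓡 n) z.1) {q₀ : Q}
    {a : Config n} (ha : a ∈ (extChartAt (𝓡 n) q₀).target) (t : ℝ) :
    mfderiv 𝓘(ℝ, Config n) (𝓡 n) (extChartAt (𝓡 n) q₀).symm a (components Y q₀ (a, t)) =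
      Y ((extChartAt (𝓡 n) q₀).symm a, t) := by
  have : IsManifold (𝓡 n) 1 Q := .of_le (n := ∞) (by simp)
  have h1 := mfderivWithin_extChartAt_symm_comp_mfderiv_extChartAt (I := 𝓡 n) ha
  rw [(𝓡 n).range_eq_univ, mfderivWithin_univ] at h1
  exact congrArg (fun A : Config n →L[ℝ] Config n => A (Y ((extChartAt (𝓡 n) q₀).symm a, t))) h1

theorem mfderiv_mfderiv_symm {q₀ : Q} {a : Config n} (ha : a ∈ (extChartAt (𝓡 n) q₀).target)
    (u : Config n) :
    (mfderiv (𝓡 n) 𝓘(ℝ, Config n) (extChartAt (𝓡 n) q₀) ((extChartAt (𝓡 n) q₀).symm a)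
      (mfderiv 𝓘(ℝ, Config n) (𝓡 n) (extChartAt (𝓡 n) q₀).symm a u) : Config n) = u := by
  have : IsManifold (𝓡 n) 1 Q := .of_le (n := ∞) (by simp)
  have h1 := mfderiv_extChartAt_comp_mfderivWithin_extChartAt_symm (I := 𝓡 n) ha
  rw [(𝓡 n).range_eq_univ, mfderivWithin_univ] at h1
  exact congrArg (fun A : Config n →L[ℝ] Config n => A u) h1

/-- `j¹Ỹ` projects to `Y` on `Q`. -/
theorem mfderiv_base_jetLift (Y : ∀ z : Q × ℝ, TangentSpace (𝓡 n) z.1) (x : Phase n Q) :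
    mfderiv (phaseModel n) (𝓡 n) (fun y : Phase n Q => y.1.proj) x (jetLift Y x) =
      Y (x.1.proj, x.2) := by
  have hz := mem_extChartAt_target (I := phaseModel n) x
  have h1 := mfderiv_base_extChartAt_symm hz
    (prolong (components Y x.1.proj) (extChartAt (phaseModel n) x x))
  rw [extChartAt_to_inv] at h1
  rw [jetLift_eq]
  refine h1.trans ((mfderiv_symm_components Y (mem_extChartAt_phase_target.1 hz) _).trans ?_)
  rw [extChartAt_phase_apply (mem_extChartAt_source x.1.proj)]
  let Y' : Q × ℝ → Config n := Y
  exact congrArg (fun q => Y' (q, x.2)) (extChartAt_to_inv (I := 𝓡 n) x.1.proj)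

theorem dt_jetLift (Y : ∀ z : Q × ℝ, TangentSpace (𝓡 n) z.1) (x : Phase n Q) :
    dt x (jetLift Y x) = 1 := by
  have h1 := dt_extChartAt_symm (mem_extChartAt_target (I := phaseModel n) x)
    (prolong (components Y x.1.proj) (extChartAt (phaseModel n) x x))
  rw [extChartAt_to_inv] at h1
  rw [jetLift_eq]
  exact h1

theorem Theta_apply (L : Phase n Q → ℝ) (x : Phase n Q) (w : TangentSpace (phaseModel n) x) :
    Theta L x (fun _ => w) = differential L x (vertLift x
      (mfderiv (phaseModel n) (𝓡 n) (fun y : Phase n Q => y.1.proj) x w - dt x w • x.1.2)) +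
      L x * dt x w := rfl

theorem energy_eq (L : Phase n Q → ℝ) (Y : ∀ z : Q × ℝ, TangentSpace (𝓡 n) z.1)
    (x : Phase n Q) :
    energy L Y x = -(differential L x (vertLift x (Y (x.1.proj, x.2) - x.1.2)) + L x) := by
  rw [energy, Theta_apply, mfderiv_base_jetLift, dt_jetLift, one_smul, mul_one]

/-- `Θ_L^V = Θ_L + E_L^∇ dt`. -/
theorem ThetaV_apply_eq_add (L : Phase n Q → ℝ) (Y : ∀ z : Q × ℝ, TangentSpace (𝓡 n) z.1)
    (x : Phase n Q) (w : TangentSpace (phaseModel n) x) :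
    ThetaV L Y x (fun _ => w) = Theta L x (fun _ => w) + energy L Y x * dt x w := by
  have h1 : ThetaH L Y x (fun _ => w) = dt x w * Theta L x (fun _ => jetLift Y x) := by
    refine (MForm.wedge_apply _ _ _).trans ?_
    rw [Fin.sum_univ_one]
    have e : Matrix.vecCons (jetLift Y x) ((0 : Fin 1).removeNth fun _ : Fin 1 => w) =
        fun _ => jetLift Y x := by
      funext i
      rw [Subsingleton.elim i 0]
      rfl
    have e' : MForm.contract (phaseModel n) (jetLift Y x) (Theta L x)
        ((0 : Fin 1).removeNth fun _ : Fin 1 => w) = Theta L x (fun _ => jetLift Y x) :=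
      congrArg (Theta L x) e
    rw [e', Fin.val_zero, pow_zero, one_mul]
  have h2 : ThetaV L Y x (fun _ => w) = Theta L x (fun _ => w) - ThetaH L Y x (fun _ => w) := rfl
  rw [h2, h1, energy]
  ring

/-- `Θ_L^V = dL ∘ 𝒮 ∘ (dq - Y dt)`, where `𝒮` is the vertical lift: the velocity in the structure
form is replaced by `Y`. -/
theorem ThetaV_apply (L : Phase n Q → ℝ) (Y : ∀ z : Q × ℝ, TangentSpace (𝓡 n) z.1)
    (x : Phase n Q) (w : TangentSpace (phaseModel n) x) :
    ThetaV L Y x (fun _ => w) = differential L x (vertLift x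
      (mfderiv (phaseModel n) (𝓡 n) (fun y : Phase n Q => y.1.proj) x w -
        dt x w • Y (x.1.proj, x.2))) := by
  rw [ThetaV_apply_eq_add, Theta_apply, energy_eq]
  simp only [map_sub, map_smul, smul_eq_mul]
  ring

end Lagr

/-! ### The lift in an arbitrary natural chart -/

namespace Lagr

/-- The prolongation is natural under a change of coordinates `τ` of the configuration space: the
second derivative of `τ` enters both sides symmetrically. -/
theorem fderiv_apply_prolong {n : ℕ} {τ : Config n → Config n} {Γ Γ' : Config n × ℝ → Config n}
    {T : PhaseCoords n → PhaseCoords n} {z : PhaseCoords n} (hτ : ContDiffAt ℝ 2 τ z.1.1)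
    (hΓ : DifferentiableAt ℝ Γ (z.1.1, z.2)) (hΓ' : DifferentiableAt ℝ Γ' (τ z.1.1, z.2))
    (hΓΓ' : ∀ᶠ p in 𝓝 (z.1.1, z.2), Γ' (τ p.1, p.2) = fderiv ℝ τ p.1 (Γ p))
    (hT : T =ᶠ[𝓝 z] fun y => ((τ y.1.1, fderiv ℝ τ y.1.1 y.1.2), y.2)) :
    fderiv ℝ T z (prolong Γ z) = prolong Γ' (T z) := by
  have hτ1 : HasFDerivAt τ (fderiv ℝ τ z.1.1) z.1.1 :=
    (hτ.differentiableAt (by simp)).hasFDerivAt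
  have hτ2 : HasFDerivAt (fderiv ℝ τ) (fderiv ℝ (fderiv ℝ τ) z.1.1) z.1.1 :=
    ((hτ.fderiv_right (m := 1) (by norm_num)).differentiableAt (by simp)).hasFDerivAt
  have hq : HasFDerivAt (fun y : PhaseCoords n => y.1.1)
      ((ContinuousLinearMap.fst ℝ (Config n) (Config n)).comp
        (ContinuousLinearMap.fst ℝ (Config n × Config n) ℝ)) z :=
    hasFDerivAt_fst.comp z hasFDerivAt_fst
  have hv : HasFDerivAt (fun y : PhaseCoords n => y.1.2)
      ((ContinuousLinearMap.snd ℝ (Config n) (Config n)).comp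
        (ContinuousLinearMap.fst ℝ (Config n × Config n) ℝ)) z :=
    hasFDerivAt_snd.comp z hasFDerivAt_fst
  have hTd := ((hτ1.comp z hq).prodMk ((hτ2.comp z hq).clm_apply hv)).prodMk
    (hasFDerivAt_snd (𝕜 := ℝ) (p := z))
  have hTd' := (hTd.congr_of_eventuallyEq hT).fderiv
  have h1 : HasFDerivAt (fun p : Config n × ℝ => (τ p.1, p.2))
      (((fderiv ℝ τ z.1.1).comp (ContinuousLinearMap.fst ℝ (Config n) ℝ)).prod
        (ContinuousLinearMap.snd ℝ (Config n) ℝ)) (z.1.1, z.2) :=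
    (HasFDerivAt.comp (z.1.1, z.2) (by exact hτ1) hasFDerivAt_fst).prodMk hasFDerivAt_snd
  have h2 := HasFDerivAt.comp (g := Γ') (z.1.1, z.2) hΓ'.hasFDerivAt h1
  have h3 : HasFDerivAt (fun p : Config n × ℝ => fderiv ℝ τ p.1 (Γ p)) _ (z.1.1, z.2) :=
    (HasFDerivAt.comp (g := fderiv ℝ τ) (z.1.1, z.2) (by exact hτ2) hasFDerivAt_fst).clm_apply
      hΓ.hasFDerivAt
  have h4 := congrArg (fun A : Config n × ℝ →L[ℝ] Config n => A (z.1.2, 1))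
    (h2.unique (h3.congr_of_eventuallyEq hΓΓ'))
  have hsymm : fderiv ℝ (fderiv ℝ τ) z.1.1 (Γ (z.1.1, z.2)) z.1.2 =
      fderiv ℝ (fderiv ℝ τ) z.1.1 z.1.2 (Γ (z.1.1, z.2)) :=
    hτ.isSymmSndFDerivAt (by simp) _ _
  have hTz := hT.eq_of_nhds
  simp at h4
  rw [hTd', hTz]
  simp only [prolong]
  refine Prod.ext (Prod.ext ?_ ?_) rfl
  · exact hΓΓ'.self_of_nhds.symm
  · simp [h4, hsymm]

variable {n : ℕ} {Q : Type*} [TopologicalSpace Q] [ChartedSpace (EuclideanSpace ℝ (Fin n)) Q]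
  [IsManifold (𝓡 n) ∞ Q]

theorem contDiffOn_components {Y : ∀ z : Q × ℝ, TangentSpace (𝓡 n) z.1} (hY : SmoothAlong Y)
    (q₀ : Q) :
    ContDiffOn ℝ ∞ (components Y q₀) ((extChartAt (𝓡 n) q₀).target ×ˢ univ) := by
  let x₀ : Phase n Q := (⟨q₀, 0⟩, 0)
  let s : Config n × ℝ → Phase n Q := fun p =>
    (⟨(extChartAt (𝓡 n) q₀).symm p.1, Y ((extChartAt (𝓡 n) q₀).symm p.1, p.2)⟩, 0)
  have h0 : ContMDiffOn 𝓘(ℝ, Config n × ℝ) ((𝓡 n).prod 𝓘(ℝ, ℝ)) ∞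
      (fun p : Config n × ℝ => ((extChartAt (𝓡 n) q₀).symm p.1, p.2))
      ((extChartAt (𝓡 n) q₀).target ×ˢ univ) :=
    ((contMDiffOn_extChartAt_symm q₀).comp contDiff_fst.contMDiff.contMDiffOn
      fun p hp => hp.1).prodMk contDiff_snd.contMDiff.contMDiffOn
  have h1 : ContMDiffOn 𝓘(ℝ, Config n × ℝ) (phaseModel n) ∞ s
      ((extChartAt (𝓡 n) q₀).target ×ˢ univ) :=
    (hY.comp_contMDiffOn h0).prodMk contMDiffOn_const
  have h2 : ContMDiffOn 𝓘(ℝ, Config n × ℝ) 𝓘(ℝ, PhaseCoords n) ∞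
      (extChartAt (phaseModel n) x₀ ∘ s) ((extChartAt (𝓡 n) q₀).target ×ˢ univ) := by
    refine (contMDiffOn_extChartAt (x := x₀)).comp h1 fun p hp => ?_
    rw [mem_preimage, ← extChartAt_source (phaseModel n)]
    exact mem_extChartAt_phase_source.2 ((extChartAt (𝓡 n) q₀).map_target hp.1)
  have h3 : ContDiffOn ℝ ∞ (fun p => (extChartAt (phaseModel n) x₀ (s p)).1.2)
      ((extChartAt (𝓡 n) q₀).target ×ˢ univ) :=
    (contDiff_snd.comp contDiff_fst).comp_contDiffOn h2.contDiffOn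
  refine h3.congr fun p hp => ?_
  rw [extChartAt_phase_apply (x := s p) ((extChartAt (𝓡 n) q₀).map_target hp.1)]
  rfl

theorem contDiffAt_components {Y : ∀ z : Q × ℝ, TangentSpace (𝓡 n) z.1} (hY : SmoothAlong Y)
    {q₀ : Q} {a : Config n} (ha : a ∈ (extChartAt (𝓡 n) q₀).target) (t : ℝ) :
    ContDiffAt ℝ ∞ (components Y q₀) (a, t) :=
  (contDiffOn_components hY q₀).contDiffAt
    (((isOpen_extChartAt_target q₀).prod isOpen_univ).mem_nhds ⟨ha, mem_univ _⟩)

/-- The coordinate expression of `j¹Ỹ` is the same in every natural chart. -/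
theorem jetLift_extChartAt_symm {Y : ∀ z : Q × ℝ, TangentSpace (𝓡 n) z.1} (hY : SmoothAlong Y)
    {x₀ : Phase n Q} {z : PhaseCoords n} (hz : z ∈ (extChartAt (phaseModel n) x₀).target) :
    jetLift Y ((extChartAt (phaseModel n) x₀).symm z) =
      mfderiv 𝓘(ℝ, PhaseCoords n) (phaseModel n) (extChartAt (phaseModel n) x₀).symm z
        (prolong (components Y x₀.1.proj) z) := by
  set x := (extChartAt (phaseModel n) x₀).symm z with hx
  have ha := mem_extChartAt_phase_target.1 hz
  have hxp : x.1.proj = (extChartAt (𝓡 n) x₀.1.proj).symm z.1.1 := by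
    rw [hx, extChartAt_phase_symm_apply hz]
  have hx2 : x.2 = z.2 := by rw [hx, extChartAt_phase_symm_apply hz]
  let τ : Config n → Config n := extChartAt (𝓡 n) x.1.proj ∘ (extChartAt (𝓡 n) x₀.1.proj).symm
  let T : PhaseCoords n → PhaseCoords n :=
    extChartAt (phaseModel n) x ∘ (extChartAt (phaseModel n) x₀).symm
  -- Near `q₀ = κ₀ (q)`, points are in the domain of the chart at `q`.
  have hnear : ∀ᶠ a in 𝓝 z.1.1, a ∈ (extChartAt (𝓡 n) x₀.1.proj).target ∧
      (extChartAt (𝓡 n) x₀.1.proj).symm a ∈ (extChartAt (𝓡 n) x.1.proj).source := by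
    refine Filter.Eventually.and ((isOpen_extChartAt_target _).mem_nhds ha) ?_
    refine (MForm.contMDiffAt_extChartAt_symm (I := 𝓡 n) ha).continuousAt.eventually
      ((isOpen_extChartAt_source _).mem_nhds ?_)
    rw [← hxp]
    exact mem_extChartAt_source _
  have hκ : ∀ a, a ∈ (extChartAt (𝓡 n) x₀.1.proj).target ∧
      (extChartAt (𝓡 n) x₀.1.proj).symm a ∈ (extChartAt (𝓡 n) x.1.proj).source →
      ContMDiffAt 𝓘(ℝ, Config n) 𝓘(ℝ, Config n) ∞ τ a ∧ ∀ u : Config n, fderiv ℝ τ a u =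
        mfderiv (𝓡 n) 𝓘(ℝ, Config n) (extChartAt (𝓡 n) x.1.proj)
          ((extChartAt (𝓡 n) x₀.1.proj).symm a) (mfderiv 𝓘(ℝ, Config n) (𝓡 n)
            (extChartAt (𝓡 n) x₀.1.proj).symm a u) := by
    intro a ha
    have e1 := MForm.contMDiffAt_extChartAt_symm (I := 𝓡 n) ha.1
    have e2 : ContMDiffAt (𝓡 n) 𝓘(ℝ, Config n) ∞ (extChartAt (𝓡 n) x.1.proj)
        ((extChartAt (𝓡 n) x₀.1.proj).symm a) := contMDiffAt_extChartAt' (by simpa using ha.2)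
    refine ⟨e2.comp a e1, fun u => ?_⟩
    rw [← mfderiv_eq_fderiv, mfderiv_comp a (e2.mdifferentiableAt (by simp))
      (e1.mdifferentiableAt (by simp))]
    rfl
  have hproj : ∀ᶠ y in 𝓝 z, y.1.1 ∈ (extChartAt (𝓡 n) x₀.1.proj).target ∧
      (extChartAt (𝓡 n) x₀.1.proj).symm y.1.1 ∈ (extChartAt (𝓡 n) x.1.proj).source :=
    (continuous_fst.comp continuous_fst).continuousAt.eventually hnear
  have hT : T =ᶠ[𝓝 z] fun y => ((τ y.1.1, fderiv ℝ τ y.1.1 y.1.2), y.2) := by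
    filter_upwards [hproj] with y hy
    have e1 := extChartAt_phase_symm_apply (mem_extChartAt_phase_target.2 hy.1)
    refine (congrArg (extChartAt (phaseModel n) x) e1).trans
      ((extChartAt_phase_apply (by exact hy.2)).trans ?_)
    exact Prod.ext (Prod.ext rfl ((hκ _ hy).2 _).symm) rfl
  have hΓΓ' : ∀ᶠ p in 𝓝 (z.1.1, z.2),
      components Y x.1.proj (τ p.1, p.2) = fderiv ℝ τ p.1 (components Y x₀.1.proj p) := by
    filter_upwards [continuousAt_fst.eventually hnear] with p hp
    rw [(hκ _ hp).2]
    have e1 := mfderiv_symm_components Y hp.1 p.2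
    refine Eq.trans ?_ (congrArg (mfderiv (𝓡 n) 𝓘(ℝ, Config n) (extChartAt (𝓡 n) x.1.proj)
          ((extChartAt (𝓡 n) x₀.1.proj).symm p.1)) e1).symm
    let G : Q → Config n := fun q => mfderiv (𝓡 n) 𝓘(ℝ, Config n) (extChartAt (𝓡 n) x.1.proj) q
      (Y (q, p.2))
    exact congrArg G ((extChartAt (𝓡 n) x.1.proj).left_inv hp.2)
  have hxs : extChartAt (phaseModel n) x x ∈ (extChartAt (phaseModel n) x).target :=
    mem_extChartAt_target x
  have hTz : T z = extChartAt (phaseModel n) x x := rfl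
  have hkey : fderiv ℝ T z (prolong (components Y x₀.1.proj) z) =
      prolong (components Y x.1.proj) (T z) := by
    refine fderiv_apply_prolong ((hκ _ hnear.self_of_nhds).1.contDiffAt.of_le ENat.LEInfty.out)
      ((contDiffAt_components hY ha z.2).differentiableAt (by simp)) ?_ hΓΓ' hT
    refine (contDiffAt_components hY ?_ z.2).differentiableAt (by simp)
    exact (extChartAt (𝓡 n) x.1.proj).map_source hnear.self_of_nhds.2
  have hTd : MDifferentiableAt 𝓘(ℝ, PhaseCoords n) 𝓘(ℝ, PhaseCoords n) T z :=
    (mdifferentiableAt_extChartAt (mem_chart_source _ x)).comp z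
      (mdifferentiableAt_extChartAt_phase_symm hz)
  have hcomp : (extChartAt (phaseModel n) x₀).symm =ᶠ[𝓝 z]
      (extChartAt (phaseModel n) x).symm ∘ T := by
    have e1 := (mdifferentiableAt_extChartAt_phase_symm hz).continuousAt.eventually
      (extChartAt_source_mem_nhds (I := phaseModel n) x)
    filter_upwards [e1] with y hy
    exact ((extChartAt (phaseModel n) x).left_inv hy).symm
  have hd := hcomp.mfderiv_eq (I := 𝓘(ℝ, PhaseCoords n)) (I' := phaseModel n)
  rw [mfderiv_comp z (mdifferentiableAt_extChartAt_phase_symm hxs) hTd, mfderiv_eq_fderiv] at hd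
  rw [jetLift_eq]
  have hfin := congrArg (fun A : PhaseCoords n →L[ℝ] PhaseCoords n =>
    A (prolong (components Y x₀.1.proj) z)) hd
  refine Eq.trans ?_ hfin.symm
  exact congrArg (mfderiv 𝓘(ℝ, PhaseCoords n) (phaseModel n) (extChartAt (phaseModel n) x).symm
    (extChartAt (phaseModel n) x x)) hkey.symm

end Lagr

/-! ### Orbits of the lift -/

/-- The total space of a bundle with Hausdorff base and fibre is Hausdorff. -/
theorem FiberBundle.t2Space_totalSpace {B F : Type*} (V : B → Type*) [TopologicalSpace B]
    [TopologicalSpace F] [TopologicalSpace (Bundle.TotalSpace F V)] [∀ b, TopologicalSpace (V b)]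
    [FiberBundle F V] [T2Space B] [T2Space F] : T2Space (Bundle.TotalSpace F V) := by
  refine ⟨fun x y hxy => ?_⟩
  by_cases hp : x.proj = y.proj
  · let e := trivializationAt F V x.proj
    have hx : x ∈ e.source := e.mem_source.2 (mem_baseSet_trivializationAt F V x.proj)
    have hy : y ∈ e.source := e.mem_source.2 (hp ▸ mem_baseSet_trivializationAt F V x.proj)
    obtain ⟨u, v, hu, hv, hxu, hyv, huv⟩ := t2_separation (e.injOn.ne hx hy hxy)
    exact ⟨e.source ∩ e ⁻¹' u, e.source ∩ e ⁻¹' v,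
      e.continuousOn.isOpen_inter_preimage e.open_source hu,
      e.continuousOn.isOpen_inter_preimage e.open_source hv, ⟨hx, hxu⟩, ⟨hy, hyv⟩,
      (huv.preimage e).mono inter_subset_right inter_subset_right⟩
  · exact separated_by_continuous (FiberBundle.continuous_proj F V) hp

section IntegralCurves

variable {E : Type*} [NormedAddCommGroup E] [NormedSpace ℝ E]
  {H : Type*} [TopologicalSpace H] {I : ModelWithCorners ℝ E H}
  {M : Type*} [TopologicalSpace M] [ChartedSpace H M] [IsManifold I 1 M] [BoundarylessManifold I M]
  [T2Space M] {v : ∀ x : M, TangentSpace I x}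

/-- Integral curves on an open interval that agree at one time agree on the interval. -/
theorem IsMIntegralCurveOn.eqOn_of_ordConnected {γ γ' : ℝ → M} {J : Set ℝ} (hJ : IsOpen J)
    (hJc : J.OrdConnected) (hv : ContMDiff I I.tangent 1 (fun x => (⟨x, v x⟩ : TangentBundle I M)))
    (hγ : IsMIntegralCurveOn γ v J) (hγ' : IsMIntegralCurveOn γ' v J) {b : ℝ} (hb : b ∈ J)
    (h : γ b = γ' b) : EqOn γ γ' J := by
  intro s hs
  -- A bounded open interval inside `J` that contains both `b` and `s`.
  obtain ⟨l, hl, hlJ⟩ := exists_Ioc_subset_of_mem_nhds (hJ.mem_nhds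
    (show min b s ∈ J by rcases min_choice b s with h | h <;> rwa [h])) (exists_lt _)
  obtain ⟨u, hu, huJ⟩ := exists_Ico_subset_of_mem_nhds (hJ.mem_nhds
    (show max b s ∈ J by rcases max_choice b s with h | h <;> rwa [h])) (exists_gt _)
  have hsub : Ioo l u ⊆ J := by
    intro t ht
    rcases le_total t (min b s) with h1 | h1
    · exact hlJ ⟨ht.1, h1⟩
    · rcases le_total (max b s) t with h2 | h2
      · exact huJ ⟨h2, ht.2⟩
      · refine hJc.out (hlJ ⟨hl, le_rfl⟩) (huJ ⟨le_rfl, hu⟩) ⟨h1, h2⟩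
  exact isMIntegralCurveOn_Ioo_eqOn_of_contMDiff_boundaryless (t₀ := b)
    ⟨hl.trans_le (min_le_left _ _), (le_max_left _ _).trans_lt hu⟩ hv (hγ.mono hsub)
    (hγ'.mono hsub) h ⟨hl.trans_le (min_le_right _ _), (le_max_right _ _).trans_lt hu⟩

/-- Integral curves on open intervals that agree at a common time can be glued. -/
theorem IsMIntegralCurveOn.exists_union {γ γ' : ℝ → M} {J J' : Set ℝ} (hJ : IsOpen J)
    (hJc : J.OrdConnected) (hJ' : IsOpen J') (hJc' : J'.OrdConnected)
    (hv : ContMDiff I I.tangent 1 (fun x => (⟨x, v x⟩ : TangentBundle I M)))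
    (hγ : IsMIntegralCurveOn γ v J) (hγ' : IsMIntegralCurveOn γ' v J') {b : ℝ} (hb : b ∈ J)
    (hb' : b ∈ J') (h : γ b = γ' b) :
    ∃ δ : ℝ → M, IsMIntegralCurveOn δ v (J ∪ J') ∧ EqOn δ γ J ∧ EqOn δ γ' J' := by
  classical
  have heq : EqOn γ γ' (J ∩ J') :=
    IsMIntegralCurveOn.eqOn_of_ordConnected (hJ.inter hJ') (hJc.inter hJc') hv
      (hγ.mono inter_subset_left) (hγ'.mono inter_subset_right) ⟨hb, hb'⟩ h
  let δ : ℝ → M := fun s => if s ∈ J then γ s else γ' s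
  have hδ : EqOn δ γ J := fun s hs => if_pos hs
  have hδ' : EqOn δ γ' J' := fun s hs => by
    by_cases hsJ : s ∈ J
    · exact (if_pos hsJ).trans (heq ⟨hsJ, hs⟩)
    · exact if_neg hsJ
  refine ⟨δ, ?_, hδ, hδ'⟩
  have main : ∀ {η : ℝ → M} {S : Set ℝ}, IsOpen S → IsMIntegralCurveOn η v S → EqOn δ η S →
      ∀ s ∈ S, IsMIntegralCurveAt δ v s := by
    intro η S hS hη hδη s hs
    refine IsMIntegralCurveOn.isMIntegralCurveAt (s := S) (fun t ht => ?_) (hS.mem_nhds hs)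
    have h1 := (hη t ht).congr_of_eventuallyEq
      (Filter.eventuallyEq_of_mem self_mem_nhdsWithin hδη) (hδη ht)
    rwa [← hδη ht] at h1
  refine IsMIntegralCurveAt.isMIntegralCurveOn fun s hs => ?_
  rcases hs with hs | hs
  · exact main hJ hγ hδ s hs
  · exact main hJ' hγ' hδ' s hs

end IntegralCurves

namespace Lagr

variable {n : ℕ} {Q : Type*} [TopologicalSpace Q] [ChartedSpace (EuclideanSpace ℝ (Fin n)) Q]
  [IsManifold (𝓡 n) ∞ Q] {Y : ∀ z : Q × ℝ, TangentSpace (𝓡 n) z.1}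

theorem contDiffAt_prolong {Γ : Config n × ℝ → Config n} {z : PhaseCoords n}
    (hΓ : ContDiffAt ℝ ∞ Γ (z.1.1, z.2)) : ContDiffAt ℝ ∞ (prolong Γ) z := by
  have h1 : ContDiffAt ℝ ∞ (fun y : PhaseCoords n => (y.1.1, y.2)) z := by fun_prop
  have h2 : ContDiffAt ℝ ∞ (fderiv ℝ Γ) (z.1.1, z.2) := hΓ.fderiv_right (by simp)
  have h3 : ContDiffAt ℝ ∞ (fun y : PhaseCoords n => (y.1.2, (1 : ℝ))) z := by fun_prop
  exact ((ContDiffAt.comp (g := Γ) z hΓ h1).prodMk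
    ((ContDiffAt.comp (g := fderiv ℝ Γ) z h2 h1).clm_apply h3)).prodMk contDiffAt_const

/-- `j¹Ỹ` is a `C¹` vector field, as the uniqueness of its integral curves requires. -/
theorem contMDiff_jetLift (hY : SmoothAlong Y) :
    ContMDiff (phaseModel n) (phaseModel n).tangent 1
      (fun x => (⟨x, jetLift Y x⟩ : TangentBundle (phaseModel n) (Phase n Q))) := by
  intro x₀
  let φ := extChartAt (phaseModel n) x₀
  let P := prolong (components Y x₀.1.proj)
  have hφ : ContMDiffAt (phaseModel n) 𝓘(ℝ, PhaseCoords n) 1 φ x₀ := contMDiffAt_extChartAt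
  have hP : ContMDiffAt 𝓘(ℝ, PhaseCoords n) 𝓘(ℝ, PhaseCoords n).tangent 1
      (fun z => (⟨z, P z⟩ : TangentBundle 𝓘(ℝ, PhaseCoords n) (PhaseCoords n))) (φ x₀) := by
    refine contMDiffAt_vectorSpace_iff_contDiffAt.2 ((contDiffAt_prolong ?_).of_le ENat.LEInfty.out)
    exact contDiffAt_components hY
      (mem_extChartAt_phase_target.1 (mem_extChartAt_target x₀)) _
  have hψ : ContMDiffOn 𝓘(ℝ, PhaseCoords n).tangent (phaseModel n).tangent 1
      (tangentMapWithin 𝓘(ℝ, PhaseCoords n) (phaseModel n) φ.symm φ.target)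
      (Bundle.TotalSpace.proj ⁻¹' φ.target) :=
    (contMDiffOn_extChartAt_symm (n := ∞) x₀).contMDiffOn_tangentMapWithin (m := 1) 
      (by rw [one_add_one_eq_two]; exact ENat.LEInfty.out)
      (isOpen_extChartAt_target x₀).uniqueMDiffOn
  have h1 := (hψ.contMDiffAt (x := (⟨φ x₀, P (φ x₀)⟩ :
    TangentBundle 𝓘(ℝ, PhaseCoords n) (PhaseCoords n)))
    (((isOpen_extChartAt_target x₀).preimage
      (FiberBundle.continuous_proj _ _)).mem_nhds (mem_extChartAt_target x₀))).comp x₀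
    (hP.comp x₀ hφ)
  refine h1.congr_of_eventuallyEq ?_
  filter_upwards [extChartAt_source_mem_nhds (I := phaseModel n) x₀] with x hx
  have hz : φ x ∈ φ.target := φ.map_source hx
  have h2 := jetLift_extChartAt_symm hY hz
  have h3 : φ.symm (φ x) = x := φ.left_inv hx
  have h4 : mfderivWithin 𝓘(ℝ, PhaseCoords n) (phaseModel n) φ.symm φ.target (φ x) =
      mfderiv 𝓘(ℝ, PhaseCoords n) (phaseModel n) φ.symm (φ x) :=
    mfderivWithin_of_isOpen (isOpen_extChartAt_target x₀) hz
  simp only [Function.comp_apply, tangentMapWithin]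
  rw [h4, ← h2, h3]

theorem hasMFDerivAt_of_isMIntegralCurveOn {γ : ℝ → Phase n Q} {J : Set ℝ} (hJ : IsOpen J)
    (hγ : IsMIntegralCurveOn γ (jetLift Y) J) {s : ℝ} (hs : s ∈ J) :
    HasMFDerivAt 𝓘(ℝ, ℝ) (phaseModel n) γ s
      ((1 : ℝ →L[ℝ] ℝ).smulRight (jetLift Y (γ s))) :=
  (hγ s hs).hasMFDerivAt (hJ.mem_nhds hs)

/-- Along an integral curve of `j¹Ỹ`, a function changes with the rate given by its differential. -/
theorem hasDerivAt_comp_integralCurve {γ : ℝ → Phase n Q} {J : Set ℝ} (hJ : IsOpen J)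
    (hγ : IsMIntegralCurveOn γ (jetLift Y) J) {s : ℝ} (hs : s ∈ J) {g : Phase n Q → ℝ}
    (hg : MDifferentiableAt (phaseModel n) 𝓘(ℝ, ℝ) g (γ s)) :
    HasDerivAt (g ∘ γ) (differential g (γ s) (jetLift Y (γ s))) s := by
  have h1 : HasFDerivAt (g ∘ γ) (_ : ℝ →L[ℝ] ℝ) s := (hg.hasMFDerivAt.comp s
    (hasMFDerivAt_of_isMIntegralCurveOn hJ hγ hs)).hasFDerivAt
  refine h1.hasDerivAt.congr_deriv ?_
  exact congrArg (differential g (γ s)) (one_smul ℝ (jetLift Y (γ s)))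

theorem jetLift_ne_zero (x : Phase n Q) : jetLift Y x ≠ 0 := by
  intro h
  have h1 := dt_jetLift Y x
  rw [h, map_zero] at h1
  exact zero_ne_one h1

/-- `j¹Ỹ` is tangent to the fibres of the projection, which is constant along integral curves. -/
theorem mfderiv_proj_jetLift {m : ℕ} [ChartedSpace (EuclideanSpace ℝ (Fin m)) (Reduced Y)]
    (hY : SmoothAlong Y) (x : Phase n Q)
    (hd : MDifferentiableAt (phaseModel n) (𝓡 m) (proj Y) x) :
    (mfderiv (phaseModel n) (𝓡 m) (proj Y) x (jetLift Y x) : EuclideanSpace ℝ (Fin m)) = 0 := by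
  obtain ⟨γ, hγ0, hγ⟩ := exists_isMIntegralCurveAt_of_contMDiffAt_boundaryless (t₀ := 0)
    (contMDiff_jetLift hY x)
  obtain ⟨ε, hε, hγε⟩ := isMIntegralCurveAt_iff'.1 hγ
  have h0 : (0 : ℝ) ∈ Metric.ball (0 : ℝ) ε := Metric.mem_ball_self hε
  have h1 := hasMFDerivAt_of_isMIntegralCurveOn Metric.isOpen_ball hγε h0
  have hd' : MDifferentiableAt (phaseModel n) (𝓡 m) (proj Y) (γ 0) := by rwa [hγ0]
  have h2 := (hd'.hasMFDerivAt.comp (0 : ℝ) h1).mfderiv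
  have h3 : proj Y ∘ γ =ᶠ[𝓝 0] fun _ => proj Y (γ 0) := by
    filter_upwards [Metric.ball_mem_nhds (0 : ℝ) hε] with s hs
    refine Quotient.sound (.rel _ _ ⟨γ, _, Metric.isOpen_ball, ?_, hγε, s, hs, 0, h0, rfl, rfl⟩)
    exact (convex_ball _ _).ordConnected
  rw [h3.mfderiv_eq, mfderiv_const] at h2
  have h4 := congrArg (fun A : ℝ →L[ℝ] EuclideanSpace ℝ (Fin m) => A 1) h2
  subst hγ0
  refine Eq.trans ?_ h4.symm
  exact congrArg (mfderiv (phaseModel n) (𝓡 m) (proj Y) (γ 0)) (one_smul ℝ (jetLift Y (γ 0))).symm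

variable [T2Space Q]

theorem OnCommonCurve.trans (hY : SmoothAlong Y) {x y z : Phase n Q} (h : OnCommonCurve Y x y)
    (h' : OnCommonCurve Y y z) : OnCommonCurve Y x z := by
  have : T2Space (TangentBundle (𝓡 n) Q) := FiberBundle.t2Space_totalSpace _
  obtain ⟨γ, J, hJ, hJc, hγ, a, ha, b, hb, rfl, hy⟩ := h
  obtain ⟨γ', J', hJ', hJc', hγ', c, hc, d, hd, hy', rfl⟩ := h'
  -- The second curve is translated so that both curves pass through `y` at the time `b`.
  have hγ'' := hγ'.comp_add (c - b)
  have hopen : IsOpen {t | t + (c - b) ∈ J'} := hJ'.preimage (continuous_add_const _)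
  have hord : {t | t + (c - b) ∈ J'}.OrdConnected :=
    hJc'.preimage_mono fun s t hst => by simpa using hst
  have hb' : b ∈ {t | t + (c - b) ∈ J'} := by simpa using hc
  obtain ⟨δ, hδ, hδ1, hδ2⟩ := IsMIntegralCurveOn.exists_union hJ hJc hopen hord
    (contMDiff_jetLift hY) hγ hγ'' hb hb' (by simp [hy, hy'])
  refine ⟨δ, J ∪ {t | t + (c - b) ∈ J'}, hJ.union hopen, ?_, hδ, a, .inl ha, d - (c - b),
    .inr (by simpa using hd), hδ1 ha, ?_⟩
  · exact (hJc.isPreconnected.union b hb hb' hord.isPreconnected).ordConnected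
  · rw [hδ2 (by simpa using hd)]
    simp

/-- By uniqueness of integral curves, the orbits of `j¹Ỹ` are single integral curves. -/
theorem eq_or_onCommonCurve (hY : SmoothAlong Y) {x y : Phase n Q}
    (h : proj Y x = proj Y y) : x = y ∨ OnCommonCurve Y x y := by
  have hrel : Relation.EqvGen (OnCommonCurve Y) x y := Quotient.exact h
  clear h
  induction hrel with
  | rel x y h => exact .inr h
  | refl x => exact .inl rfl
  | symm x y _ ih =>
    rcases ih with h | ⟨γ, J, hJ, hJc, hγ, a, ha, b, hb, hx, hy⟩
    · exact .inl h.symm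
    · exact .inr ⟨γ, J, hJ, hJc, hγ, b, hb, a, ha, hy, hx⟩
  | trans x y z _ _ ih1 ih2 =>
    rcases ih1 with rfl | h1
    · exact ih2
    · rcases ih2 with rfl | h2
      · exact .inr h1
      · exact .inr (h1.trans hY h2)

/-- An orbit of `j¹Ỹ` meets every time slice at most once. -/
theorem eq_of_proj_eq_of_snd_eq (hY : SmoothAlong Y) {x y : Phase n Q}
    (h : proj Y x = proj Y y) (ht : x.2 = y.2) : x = y := by
  rcases eq_or_onCommonCurve hY h with h | ⟨γ, J, hJ, hJc, hγ, a, ha, b, hb, rfl, rfl⟩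
  · exact h
  · have hd : ∀ s ∈ J, HasDerivAt (fun s => (γ s).2 - s) 0 s := fun s hs => by
      have h1 := hasDerivAt_comp_integralCurve hJ hγ hs (g := fun y => y.2) mdifferentiableAt_snd
      have h2 : differential (fun y : Phase n Q => y.2) (γ s) (jetLift Y (γ s)) = 1 :=
        dt_jetLift Y (γ s)
      rw [h2] at h1
      exact (HasDerivAt.fun_sub h1 (hasDerivAt_id' s)).congr_deriv (sub_self 1)
    have hc := hJ.is_const_of_deriv_eq_zero hJc.isPreconnected
      (fun s hs => (hd s hs).differentiableAt.differentiableWithinAt)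
      (fun s hs => (hd s hs).deriv) ha hb
    have hab : a = b := by
      simp only [ht] at hc
      linarith
    rw [hab]

/-- The fibres of the projection are orbits, hence connected. -/
theorem isPreconnected_fibre_proj (hY : SmoothAlong Y) (p : Reduced Y) :
    IsPreconnected (proj Y ⁻¹' {p}) := by
  refine isPreconnected_of_forall_pair fun x hx y hy => ?_
  rcases eq_or_onCommonCurve hY ((show proj Y x = p from hx).trans (Eq.symm hy)) with
    rfl | ⟨γ, J, hJ, hJc, hγ, a, ha, b, hb, rfl, rfl⟩
  · exact ⟨{x}, by simpa using hx, rfl, rfl, isPreconnected_singleton⟩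
  · refine ⟨γ '' J, ?_, ⟨a, ha, rfl⟩, ⟨b, hb, rfl⟩, hJc.isPreconnected.image γ hγ.continuousOn⟩
    rintro _ ⟨s, hs, rfl⟩
    refine Eq.trans ?_ hx
    exact Quotient.sound (.rel _ _ ⟨γ, J, hJ, hJc, hγ, s, hs, a, ha, rfl, rfl⟩)

end Lagr

/-! ### Calculus in natural coordinates -/

/-- The exterior derivative of a `1`-form that is given near `x` by a covector field. -/
theorem extDeriv_apply_of_eventually {E : Type*} [NormedAddCommGroup E] [NormedSpace ℝ E]
    {α : E → E [⋀^Fin 1]→L[ℝ] ℝ} {x : E} (hα : DifferentiableAt ℝ α x) {f : E → E → ℝ}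
    (h : ∀ᶠ y in 𝓝 x, ∀ w, α y (fun _ => w) = f y w) (a b : E) :
    extDeriv α x ![a, b] = fderiv ℝ (f · b) x a - fderiv ℝ (f · a) x b := by
  have h1 : ∀ w, fderiv ℝ (fun y => α y (fun _ => w)) x = fderiv ℝ (f · w) x := fun w =>
    Filter.EventuallyEq.fderiv_eq (h.mono fun y hy => hy w)
  rw [extDeriv_apply hα, Fin.sum_univ_two, Fin.removeNth_zero_pair,
    Fin.removeNth_one_pair, h1, h1]
  simp [sub_eq_add_neg]

/-- A `1`-form given near `x` by a smooth covector field is smooth at `x`. -/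
theorem ContDiffAt.alternating_of_eventually {E : Type*} [NormedAddCommGroup E] [NormedSpace ℝ E]
    {α : E → E [⋀^Fin 1]→L[ℝ] ℝ} {A : E → E →L[ℝ] ℝ} {x : E} {r : WithTop ℕ∞}
    (hA : ContDiffAt ℝ r A x) (h : ∀ᶠ y in 𝓝 x, ∀ w, α y (fun _ => w) = A y w) :
    ContDiffAt ℝ r α x := by
  refine ((ContinuousAlternatingMap.ofSubsingletonLIE (𝕜 := ℝ) (E := E) (F := ℝ)
    (0 : Fin 1)).contDiff.contDiffAt.comp x hA).congr_of_eventuallyEq ?_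
  filter_upwards [h] with y hy
  ext v
  have e : v = fun _ => v 0 := by
    funext i
    rw [Subsingleton.elim i 0]
  rw [e, hy]
  rfl

namespace Lagr

variable {n : ℕ}

section Calculus

variable {ℓ : PhaseCoords n → ℝ} {Γ : Config n × ℝ → Config n} {z : PhaseCoords n}

/-- The vertical derivative `∂ℓ/∂v` along a variable direction. -/
theorem hasFDerivAt_momentum (hℓ : ContDiffAt ℝ 2 ℓ z) {u : PhaseCoords n → Config n}
    {u' : PhaseCoords n →L[ℝ] Config n} (hu : HasFDerivAt u u' z) :
    HasFDerivAt (fun y => fderiv ℝ ℓ y ((0, u y), 0))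
      ((fderiv ℝ ℓ z).comp ((ContinuousLinearMap.inl ℝ (Config n × Config n) ℝ).comp
        ((ContinuousLinearMap.inr ℝ (Config n) (Config n)).comp u')) +
        (fderiv ℝ (fderiv ℝ ℓ) z).flip ((0, u z), 0)) z := by
  have h1 : HasFDerivAt (fderiv ℝ ℓ) (fderiv ℝ (fderiv ℝ ℓ) z) z :=
    ((hℓ.fderiv_right (m := 1) (by norm_num)).differentiableAt (by simp)).hasFDerivAt
  have h2 : HasFDerivAt (fun y => (((0 : Config n), u y), (0 : ℝ)))
      ((ContinuousLinearMap.inl ℝ (Config n × Config n) ℝ).comp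
        ((ContinuousLinearMap.inr ℝ (Config n) (Config n)).comp u')) z :=
    ((ContinuousLinearMap.inl ℝ (Config n × Config n) ℝ).comp
      (ContinuousLinearMap.inr ℝ (Config n) (Config n))).hasFDerivAt.comp z hu
  exact h1.clm_apply h2

theorem hasFDerivAt_base (hΓ : DifferentiableAt ℝ Γ (z.1.1, z.2)) :
    HasFDerivAt (fun y : PhaseCoords n => Γ (y.1.1, y.2)) ((fderiv ℝ Γ (z.1.1, z.2)).comp
      (((ContinuousLinearMap.fst ℝ (Config n) (Config n)).comp
        (ContinuousLinearMap.fst ℝ (Config n × Config n) ℝ)).prod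
        (ContinuousLinearMap.snd ℝ (Config n × Config n) ℝ))) z :=
  HasFDerivAt.comp (g := Γ) z hΓ.hasFDerivAt
    (((ContinuousLinearMap.fst ℝ (Config n) (Config n)).comp
        (ContinuousLinearMap.fst ℝ (Config n × Config n) ℝ)).prod
        (ContinuousLinearMap.snd ℝ (Config n × Config n) ℝ)).hasFDerivAt

/-- The derivative of the identity `(j¹Ỹ) L = 0` along the vertical vector `u ∂/∂v`: the second
derivative of `ℓ` along `j¹Ỹ` and a vertical vector is expressed by first derivatives. -/
theorem sndDeriv_prolong (hℓ : ContDiffAt ℝ 2 ℓ z)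
    (hsymm : ∀ᶠ y in 𝓝 z, fderiv ℝ ℓ y (prolong Γ y) = 0) (u : Config n) :
    fderiv ℝ (fderiv ℝ ℓ) z (prolong Γ z) ((0, u), 0) =
      -fderiv ℝ ℓ z ((0, fderiv ℝ Γ (z.1.1, z.2) (u, 0)), 0) := by
  let e : PhaseCoords n := ((0, u), 0)
  let c : PhaseCoords n := ((0, fderiv ℝ Γ (z.1.1, z.2) (u, 0)), 0)
  have hline : HasDerivAt (fun s : ℝ => z + s • e) e 0 := by
    simpa using ((hasDerivAt_id (0 : ℝ)).smul_const e).const_add z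
  have h1 : HasFDerivAt (fderiv ℝ ℓ) (fderiv ℝ (fderiv ℝ ℓ) z) (z + (0 : ℝ) • e) := by
    rw [zero_smul, add_zero]
    exact ((hℓ.fderiv_right (m := 1) (by norm_num)).differentiableAt (by simp)).hasFDerivAt
  -- In the fibre direction the prolongation is affine.
  have hX : ∀ s : ℝ, prolong Γ (z + s • e) = prolong Γ z + s • c := by
    intro s
    have h1 : z + s • e = ((z.1.1, z.1.2 + s • u), z.2) := by
      ext1 <;> simp [e, Prod.ext_iff]
    have h2 : (z.1.2 + s • u, (1 : ℝ)) = (z.1.2, 1) + s • (u, (0 : ℝ)) := by simp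
    rw [h1]
    simp only [prolong, c]
    rw [h2, map_add, map_smul]
    simp
  have h2 : HasDerivAt (fun s : ℝ => prolong Γ z + s • c) c 0 := by
    simpa using ((hasDerivAt_id (0 : ℝ)).smul_const c).const_add (prolong Γ z)
  have h3 := (HasFDerivAt.comp_hasDerivAt (f := fun s : ℝ => z + s • e) 0 h1 hline).clm_apply h2
  have h4 : (fun s : ℝ => (fderiv ℝ ℓ ∘ fun s : ℝ => z + s • e) s (prolong Γ z + s • c)) =ᶠ[𝓝 0]
      fun _ => 0 := by
    have : Filter.Tendsto (fun s : ℝ => z + s • e) (𝓝 0) (𝓝 z) := by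
      simpa using hline.continuousAt.tendsto
    filter_upwards [this.eventually hsymm] with s hs
    rw [← hX]
    exact hs
  have h5 := h3.unique ((hasDerivAt_const (0 : ℝ) (0 : ℝ)).congr_of_eventuallyEq h4)
  simp only [Function.comp_apply, zero_smul, add_zero] at h5
  have h6 : fderiv ℝ (fderiv ℝ ℓ) z (prolong Γ z) e = fderiv ℝ (fderiv ℝ ℓ) z e (prolong Γ z) :=
    hℓ.isSymmSndFDerivAt (by simp) _ _
  exact h6.trans (eq_neg_of_add_eq_zero_left h5)

/-- The vertical Poincaré–Cartan form `(∂ℓ/∂v) (dq - Γ dt)` in natural coordinates. -/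
def coordThetaV (ℓ : PhaseCoords n → ℝ) (Γ : Config n × ℝ → Config n) (z : PhaseCoords n) :
    PhaseCoords n →L[ℝ] ℝ :=
  (fderiv ℝ ℓ z).comp ((ContinuousLinearMap.inl ℝ (Config n × Config n) ℝ).comp
    ((ContinuousLinearMap.inr ℝ (Config n) (Config n)).comp
      ((ContinuousLinearMap.fst ℝ (Config n) (Config n)).comp
        (ContinuousLinearMap.fst ℝ (Config n × Config n) ℝ) -
        (ContinuousLinearMap.snd ℝ (Config n × Config n) ℝ).smulRight (Γ (z.1.1, z.2)))))

theorem coordThetaV_apply (w : PhaseCoords n) :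
    coordThetaV ℓ Γ z w = fderiv ℝ ℓ z ((0, w.1.1 - w.2 • Γ (z.1.1, z.2)), 0) := rfl

/-- The energy `-(∂ℓ/∂v) (Γ - v) - ℓ` in natural coordinates. -/
def coordEnergy (ℓ : PhaseCoords n → ℝ) (Γ : Config n × ℝ → Config n) (z : PhaseCoords n) : ℝ :=
  -(fderiv ℝ ℓ z ((0, Γ (z.1.1, z.2) - z.1.2), 0) + ℓ z)

theorem contDiffAt_coordThetaV (hℓ : ContDiffAt ℝ ∞ ℓ z) (hΓ : ContDiffAt ℝ ∞ Γ (z.1.1, z.2)) :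
    ContDiffAt ℝ ∞ (coordThetaV ℓ Γ) z := by
  have h1 : ContDiffAt ℝ ∞ (fun y : PhaseCoords n => (y.1.1, y.2)) z := by fun_prop
  have h2 : ContDiffAt ℝ ∞ (fun y : PhaseCoords n => Γ (y.1.1, y.2)) z :=
    ContDiffAt.comp (g := Γ) z hΓ h1
  have h3 : ContDiffAt ℝ ∞ (fderiv ℝ ℓ) z := hℓ.fderiv_right (by simp)
  exact h3.clm_comp (contDiffAt_const.clm_comp (contDiffAt_const.clm_comp
    (contDiffAt_const.sub (contDiffAt_const.smulRight h2))))

theorem contDiffAt_coordEnergy (hℓ : ContDiffAt ℝ ∞ ℓ z) (hΓ : ContDiffAt ℝ ∞ Γ (z.1.1, z.2)) :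
    ContDiffAt ℝ ∞ (coordEnergy ℓ Γ) z := by
  have h1 : ContDiffAt ℝ ∞ (fun y : PhaseCoords n => (y.1.1, y.2)) z := by fun_prop
  have h2 : ContDiffAt ℝ ∞ (fun y : PhaseCoords n => Γ (y.1.1, y.2)) z :=
    ContDiffAt.comp (g := Γ) z hΓ h1
  have h3 : ContDiffAt ℝ ∞ (fderiv ℝ ℓ) z := hℓ.fderiv_right (by simp)
  have h4 : ContDiffAt ℝ ∞ (fun y : PhaseCoords n =>
      (((0 : Config n), Γ (y.1.1, y.2) - y.1.2), (0 : ℝ))) z :=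
    (contDiffAt_const.prodMk (h2.sub (by fun_prop))).prodMk contDiffAt_const
  exact ((h3.clm_apply h4).add hℓ).neg

theorem fderiv_coordThetaV_apply (hℓ : ContDiffAt ℝ 2 ℓ z)
    (hΓ : DifferentiableAt ℝ Γ (z.1.1, z.2)) (a b : PhaseCoords n) :
    fderiv ℝ (fun y => coordThetaV ℓ Γ y b) z a =
      fderiv ℝ (fderiv ℝ ℓ) z a ((0, b.1.1 - b.2 • Γ (z.1.1, z.2)), 0) -
        b.2 * fderiv ℝ ℓ z ((0, fderiv ℝ Γ (z.1.1, z.2) (a.1.1, a.2)), 0) := by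
  have h1 := (hasFDerivAt_momentum hℓ
    (((hasFDerivAt_base hΓ).const_smul b.2).const_sub b.1.1)).fderiv
  have h2 : ((0, -(b.2 • fderiv ℝ Γ (z.1.1, z.2) (a.1.1, a.2))), 0) =
      -(b.2 • (((0, fderiv ℝ Γ (z.1.1, z.2) (a.1.1, a.2)), 0) : PhaseCoords n)) := by simp
  have h3 := congrArg (fun A : PhaseCoords n →L[ℝ] ℝ => A a) h1
  refine h3.trans ?_
  change fderiv ℝ ℓ z ((0, -(b.2 • fderiv ℝ Γ (z.1.1, z.2) (a.1.1, a.2))), 0) +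
    fderiv ℝ (fderiv ℝ ℓ) z a ((0, b.1.1 - b.2 • Γ (z.1.1, z.2)), 0) = _
  rw [h2, map_neg, map_smul, smul_eq_mul]
  ring

/-- If `prolong Γ` is a symmetry of `ℓ`, then `i(prolong Γ) d(coordThetaV ℓ Γ) = 0`. -/
theorem fderiv_coordThetaV_prolong (hℓ : ContDiffAt ℝ 2 ℓ z)
    (hΓ : DifferentiableAt ℝ Γ (z.1.1, z.2))
    (hsymm : ∀ᶠ y in 𝓝 z, fderiv ℝ ℓ y (prolong Γ y) = 0) (b : PhaseCoords n) :
    fderiv ℝ (fun y => coordThetaV ℓ Γ y b) z (prolong Γ z) =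
      fderiv ℝ (fun y => coordThetaV ℓ Γ y (prolong Γ z)) z b := by
  rw [fderiv_coordThetaV_apply hℓ hΓ, fderiv_coordThetaV_apply hℓ hΓ, sndDeriv_prolong hℓ hsymm]
  have h1 : (prolong Γ z).1.1 = Γ (z.1.1, z.2) := rfl
  have h2 : (prolong Γ z).2 = 1 := rfl
  have h3 : (b.1.1 - b.2 • Γ (z.1.1, z.2), (0 : ℝ)) =
      (b.1.1, b.2) - b.2 • (Γ (z.1.1, z.2), (1 : ℝ)) := by simp
  have h4 : ∀ u v : Config n, (((0, u - b.2 • v), 0) : PhaseCoords n) =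
      ((0, u), 0) - b.2 • ((0, v), 0) := by simp
  rw [h1, h2, h3, one_smul, sub_self, map_sub, map_smul, h4, map_sub, map_smul, smul_eq_mul]
  have h5 : (((0, 0), 0) : PhaseCoords n) = 0 := rfl
  rw [h5, map_zero]
  ring

/-- If `prolong Γ` is a symmetry of `ℓ`, the energy is constant along `prolong Γ`. -/
theorem fderiv_coordEnergy_prolong (hℓ : ContDiffAt ℝ 2 ℓ z)
    (hΓ : DifferentiableAt ℝ Γ (z.1.1, z.2))
    (hsymm : ∀ᶠ y in 𝓝 z, fderiv ℝ ℓ y (prolong Γ y) = 0) :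
    fderiv ℝ (coordEnergy ℓ Γ) z (prolong Γ z) = 0 := by
  have hv : HasFDerivAt (fun y : PhaseCoords n => y.1.2)
      ((ContinuousLinearMap.snd ℝ (Config n) (Config n)).comp
        (ContinuousLinearMap.fst ℝ (Config n × Config n) ℝ)) z :=
    hasFDerivAt_snd.comp z hasFDerivAt_fst
  have h1 : HasFDerivAt (coordEnergy ℓ Γ) _ z :=
    ((hasFDerivAt_momentum hℓ ((hasFDerivAt_base hΓ).sub hv)).add
      (hℓ.differentiableAt (by simp)).hasFDerivAt).neg
  rw [h1.fderiv]
  change -((fderiv ℝ ℓ z ((0, fderiv ℝ Γ (z.1.1, z.2) (Γ (z.1.1, z.2), 1) -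
      fderiv ℝ Γ (z.1.1, z.2) (z.1.2, 1)), 0) +
    fderiv ℝ (fderiv ℝ ℓ) z (prolong Γ z) ((0, Γ (z.1.1, z.2) - z.1.2), 0)) +
    fderiv ℝ ℓ z (prolong Γ z)) = 0
  have h2 : (Γ (z.1.1, z.2) - z.1.2, (0 : ℝ)) = (Γ (z.1.1, z.2), 1) - (z.1.2, 1) := by simp
  rw [sndDeriv_prolong hℓ hsymm, hsymm.self_of_nhds, h2, map_sub]
  simp

end Calculus

variable {Q : Type*} [TopologicalSpace Q] [ChartedSpace (EuclideanSpace ℝ (Fin n)) Q]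
  [IsManifold (𝓡 n) ∞ Q] {L : Phase n Q → ℝ} {Y : ∀ z : Q × ℝ, TangentSpace (𝓡 n) z.1}
  {x₀ : Phase n Q} {z : PhaseCoords n}

theorem along_extChartAt_symm (Y : ∀ z : Q × ℝ, TangentSpace (𝓡 n) z.1)
    (hz : z ∈ (extChartAt (phaseModel n) x₀).target) :
    (Y (((extChartAt (phaseModel n) x₀).symm z).1.proj,
      ((extChartAt (phaseModel n) x₀).symm z).2) : Config n) =
      mfderiv 𝓘(ℝ, Config n) (𝓡 n) (extChartAt (𝓡 n) x₀.1.proj).symm z.1.1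
        (components Y x₀.1.proj (z.1.1, z.2)) := by
  refine Eq.trans ?_ (mfderiv_symm_components Y (mem_extChartAt_phase_target.1 hz) z.2).symm
  let Y' : Phase n Q → Config n := fun x => Y (x.1.proj, x.2)
  exact congrArg Y' (extChartAt_phase_symm_apply hz)

/-- `dL ∘ 𝒮` is the vertical derivative `∂ℓ/∂v` in natural coordinates. -/
theorem differential_vertLift_extChartAt_symm (hL : ContMDiff (phaseModel n) 𝓘(ℝ, ℝ) ∞ L)
    (hz : z ∈ (extChartAt (phaseModel n) x₀).target) (u : Config n) :
    differential L ((extChartAt (phaseModel n) x₀).symm z)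
      (vertLift ((extChartAt (phaseModel n) x₀).symm z)
        (mfderiv 𝓘(ℝ, Config n) (𝓡 n) (extChartAt (𝓡 n) x₀.1.proj).symm z.1.1 u : Config n)) =
      fderiv ℝ (L ∘ (extChartAt (phaseModel n) x₀).symm) z ((0, u), 0) := by
  have h1 := vertLift_extChartAt_symm hz
    (mfderiv 𝓘(ℝ, Config n) (𝓡 n) (extChartAt (𝓡 n) x₀.1.proj).symm z.1.1 u : Config n)
  have h2 := mfderiv_mfderiv_symm (mem_extChartAt_phase_target.1 hz) u
  refine (congrArg _ h1).trans ((differential_extChartAt_symm hL hz _).trans ?_)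
  exact congrArg (fun v : Config n =>
    fderiv ℝ (L ∘ (extChartAt (phaseModel n) x₀).symm) z ((0, v), 0)) h2

theorem inChart_ThetaV_apply (hL : ContMDiff (phaseModel n) 𝓘(ℝ, ℝ) ∞ L)
    (hz : z ∈ (extChartAt (phaseModel n) x₀).target) (w : PhaseCoords n) :
    MForm.inChart (phaseModel n) (ThetaV L Y) x₀ z (fun _ => w) =
      coordThetaV (L ∘ (extChartAt (phaseModel n) x₀).symm) (components Y x₀.1.proj) z w := by
  rw [MForm.inChart_eq_pullback, coordThetaV_apply]
  refine (ThetaV_apply L Y ((extChartAt (phaseModel n) x₀).symm z)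
    (mfderiv 𝓘(ℝ, PhaseCoords n) (phaseModel n) (extChartAt (phaseModel n) x₀).symm z w)).trans ?_
  rw [← differential_vertLift_extChartAt_symm hL hz]
  let A : Config n →L[ℝ] ℝ := (differential L ((extChartAt (phaseModel n) x₀).symm z)).comp
    (vertLift ((extChartAt (phaseModel n) x₀).symm z))
  let B : Config n →L[ℝ] Config n :=
    mfderiv 𝓘(ℝ, Config n) (𝓡 n) (extChartAt (𝓡 n) x₀.1.proj).symm z.1.1
  refine congrArg A (Eq.trans ?_ (map_sub B w.1.1 (w.2 • _)).symm)
  rw [map_smul B]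
  exact congrArg₂ (· - ·) (mfderiv_base_extChartAt_symm hz w)
    (congrArg₂ (· • ·) (dt_extChartAt_symm hz w) (along_extChartAt_symm Y hz))

theorem energy_extChartAt_symm (hL : ContMDiff (phaseModel n) 𝓘(ℝ, ℝ) ∞ L)
    (hz : z ∈ (extChartAt (phaseModel n) x₀).target) :
    energy L Y ((extChartAt (phaseModel n) x₀).symm z) =
      coordEnergy (L ∘ (extChartAt (phaseModel n) x₀).symm) (components Y x₀.1.proj) z := by
  rw [energy_eq, coordEnergy, ← differential_vertLift_extChartAt_symm hL hz]
  let A : Config n →L[ℝ] ℝ := (differential L ((extChartAt (phaseModel n) x₀).symm z)).comp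
    (vertLift ((extChartAt (phaseModel n) x₀).symm z))
  let B : Config n →L[ℝ] Config n :=
    mfderiv 𝓘(ℝ, Config n) (𝓡 n) (extChartAt (𝓡 n) x₀.1.proj).symm z.1.1
  refine congrArg (fun v : Config n => -(A v + L ((extChartAt (phaseModel n) x₀).symm z)))
    (Eq.trans ?_ (map_sub B _ z.1.2).symm)
  exact congrArg₂ (· - ·) (along_extChartAt_symm Y hz)
    (congrArg (fun x : Phase n Q => (x.1.2 : Config n)) (extChartAt_phase_symm_apply hz))

theorem contDiffAt_comp_extChartAt_symm {f : Phase n Q → ℝ}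
    (hf : ContMDiff (phaseModel n) 𝓘(ℝ, ℝ) ∞ f)
    (hz : z ∈ (extChartAt (phaseModel n) x₀).target) :
    ContDiffAt ℝ ∞ (f ∘ (extChartAt (phaseModel n) x₀).symm) z :=
  (hf.contMDiffAt.comp z (MForm.contMDiffAt_extChartAt_symm hz)).contDiffAt

theorem smooth_ThetaV (hL : ContMDiff (phaseModel n) 𝓘(ℝ, ℝ) ∞ L) (hY : SmoothAlong Y) :
    MForm.Smooth (phaseModel n) (ThetaV L Y) := by
  intro x₀ z hz
  refine ContDiffAt.contDiffWithinAt (ContDiffAt.alternating_of_eventually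
    (contDiffAt_coordThetaV (contDiffAt_comp_extChartAt_symm hL hz)
      (contDiffAt_components hY (mem_extChartAt_phase_target.1 hz) z.2)) ?_)
  filter_upwards [eventually_mem_target hz] with y hy w
  exact inChart_ThetaV_apply hL hy w

theorem contMDiff_energy (hL : ContMDiff (phaseModel n) 𝓘(ℝ, ℝ) ∞ L) (hY : SmoothAlong Y) :
    ContMDiff (phaseModel n) 𝓘(ℝ, ℝ) ∞ (energy L Y) := by
  intro x
  have hz := mem_extChartAt_target (I := phaseModel n) x
  have h1 := contDiffAt_coordEnergy (contDiffAt_comp_extChartAt_symm hL hz)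
    (contDiffAt_components hY (mem_extChartAt_phase_target.1 hz) _)
  have h2 := h1.contMDiffAt.comp x (contMDiffAt_extChartAt (I := phaseModel n) (x := x))
  refine h2.congr_of_eventuallyEq ?_
  filter_upwards [extChartAt_source_mem_nhds (I := phaseModel n) x] with y hy
  refine Eq.trans ?_ (energy_extChartAt_symm hL ((extChartAt _ x).map_source hy))
  rw [(extChartAt (phaseModel n) x).left_inv hy]

/-- The symmetry condition in natural coordinates. -/
theorem IsInfSymmetry.fderiv_prolong (hL : ContMDiff (phaseModel n) 𝓘(ℝ, ℝ) ∞ L)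
    (hY : SmoothAlong Y) (hs : IsInfSymmetry L Y)
    (hz : z ∈ (extChartAt (phaseModel n) x₀).target) :
    fderiv ℝ (L ∘ (extChartAt (phaseModel n) x₀).symm) z
      (prolong (components Y x₀.1.proj) z) = 0 := by
  rw [← differential_extChartAt_symm hL hz]
  exact (congrArg _ (jetLift_extChartAt_symm hY hz).symm).trans (hs _)

section OwnChart

/-! At the centre of a chart, the tangent space is identified with the model space by the identity
map, so that the values of fields and forms there are their coordinate expressions. -/

variable (x : Phase n Q)

theorem jetLift_eq_prolong :
    (jetLift Y x : PhaseCoords n) =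
      prolong (components Y x.1.proj) (extChartAt (phaseModel n) x x) := by
  have : IsManifold (phaseModel n) 1 (Phase n Q) := .of_le (n := ∞) (by simp)
  rw [jetLift_eq]
  have h1 := mfderivWithin_range_extChartAt_symm (I := phaseModel n) (x := x)
  rw [(phaseModel n).range_eq_univ, mfderivWithin_univ] at h1
  exact congrArg (fun A : PhaseCoords n →L[ℝ] PhaseCoords n =>
    A (prolong (components Y x.1.proj) (extChartAt (phaseModel n) x x))) h1

theorem differential_eq_fderiv {f : Phase n Q → ℝ}
    (hf : MDifferentiableAt (phaseModel n) 𝓘(ℝ, ℝ) f x) (w : PhaseCoords n) :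
    differential f x w =
      fderiv ℝ (f ∘ (extChartAt (phaseModel n) x).symm) (extChartAt (phaseModel n) x x) w := by
  have h1 := hf.mfderiv
  rw [(phaseModel n).range_eq_univ, fderivWithin_univ] at h1
  exact congrArg (fun A : PhaseCoords n →L[ℝ] ℝ => A w) h1

theorem dt_eq (w : PhaseCoords n) : dt x w = w.2 :=
  congrArg (fun A : PhaseCoords n →L[ℝ] ℝ => A w) mfderiv_snd

end OwnChart

end Lagr

/-! ### Consequences of the symmetry -/

namespace Lagr

variable {n : ℕ} {Q : Type*} [TopologicalSpace Q] [ChartedSpace (EuclideanSpace ℝ (Fin n)) Q]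
  [IsManifold (𝓡 n) ∞ Q] {L : Phase n Q → ℝ} {Y : ∀ z : Q × ℝ, TangentSpace (𝓡 n) z.1}

theorem differentiableAt_inChart_ThetaV (hL : ContMDiff (phaseModel n) 𝓘(ℝ, ℝ) ∞ L)
    (hY : SmoothAlong Y) (x : Phase n Q) :
    DifferentiableAt ℝ (MForm.inChart (phaseModel n) (ThetaV L Y) x)
      (extChartAt (phaseModel n) x x) :=
  ((smooth_ThetaV hL hY x).contDiffAt (extChartAt_target_mem_nhds x)).differentiableAt (by simp)

/-- `i(j¹Ỹ) dΘ_L^V = 0` for an infinitesimal symmetry. -/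
theorem extDer_ThetaV_jetLift (hL : ContMDiff (phaseModel n) 𝓘(ℝ, ℝ) ∞ L) (hY : SmoothAlong Y)
    (hs : IsInfSymmetry L Y) (x : Phase n Q) (b : TangentSpace (phaseModel n) x) :
    MForm.extDer (phaseModel n) (ThetaV L Y) x ![jetLift Y x, b] = 0 := by
  have hz := mem_extChartAt_target (I := phaseModel n) x
  rw [MForm.extDer_eq_extDeriv_inChart]
  refine (extDeriv_apply_of_eventually (differentiableAt_inChart_ThetaV hL hY x)
    ((eventually_mem_target hz).mono fun y hy => inChart_ThetaV_apply hL hy) _ _).trans ?_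
  rw [sub_eq_zero, jetLift_eq_prolong]
  refine fderiv_coordThetaV_prolong
    ((contDiffAt_comp_extChartAt_symm hL hz).of_le ENat.LEInfty.out)
    ((contDiffAt_components hY (mem_extChartAt_phase_target.1 hz) _).differentiableAt (by simp))
    ?_ b
  exact (eventually_mem_target hz).mono fun y hy => hs.fderiv_prolong hL hY hy

/-- `E_L^∇` is a constant of motion of `j¹Ỹ` for an infinitesimal symmetry. -/
theorem differential_energy_jetLift (hL : ContMDiff (phaseModel n) 𝓘(ℝ, ℝ) ∞ L)
    (hY : SmoothAlong Y) (hs : IsInfSymmetry L Y) (x : Phase n Q) :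
    differential (energy L Y) x (jetLift Y x) = 0 := by
  have hz := mem_extChartAt_target (I := phaseModel n) x
  have h1 : energy L Y ∘ (extChartAt (phaseModel n) x).symm =ᶠ[𝓝 (extChartAt (phaseModel n) x x)]
      coordEnergy (L ∘ (extChartAt (phaseModel n) x).symm) (components Y x.1.proj) :=
    (eventually_mem_target hz).mono fun y hy => energy_extChartAt_symm hL hy
  refine (differential_eq_fderiv x ((contMDiff_energy hL hY).mdifferentiableAt (by simp))
    _).trans ?_
  rw [h1.fderiv_eq, jetLift_eq_prolong]
  refine fderiv_coordEnergy_prolong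
    ((contDiffAt_comp_extChartAt_symm hL hz).of_le ENat.LEInfty.out)
    ((contDiffAt_components hY (mem_extChartAt_phase_target.1 hz) _).differentiableAt (by simp)) ?_
  exact (eventually_mem_target hz).mono fun y hy => hs.fderiv_prolong hL hY hy

/-- Since `Θ_L = Θ_L^V - E_L^∇ dt`, one has `dΘ_L = dΘ_L^V - dE_L^∇ ∧ dt`. -/
theorem extDer_Theta_apply (hL : ContMDiff (phaseModel n) 𝓘(ℝ, ℝ) ∞ L) (hY : SmoothAlong Y)
    (x : Phase n Q) (a b : TangentSpace (phaseModel n) x) :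
    MForm.extDer (phaseModel n) (Theta L) x ![a, b] =
      MForm.extDer (phaseModel n) (ThetaV L Y) x ![a, b] -
        (differential (energy L Y) x a * dt x b - differential (energy L Y) x b * dt x a) := by
  let φ := extChartAt (phaseModel n) x
  let α : PhaseCoords n → PhaseCoords n [⋀^Fin 1]→L[ℝ] ℝ :=
    MForm.inChart (phaseModel n) (ThetaV L Y) x
  let ε : PhaseCoords n → ℝ := energy L Y ∘ φ.symm
  have hz : φ x ∈ φ.target := mem_extChartAt_target x
  have hE := contMDiff_energy hL hY
  have hα : ContDiffAt ℝ ∞ α (φ x) :=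
    (smooth_ThetaV hL hY x).contDiffAt (extChartAt_target_mem_nhds x)
  have hε : ContDiffAt ℝ ∞ ε (φ x) := contDiffAt_comp_extChartAt_symm hE hz
  have heq : ∀ᶠ y in 𝓝 (φ x), ∀ w : PhaseCoords n,
      MForm.inChart (phaseModel n) (Theta L) x y (fun _ => w) = α y (fun _ => w) - ε y * w.2 := by
    filter_upwards [eventually_mem_target hz] with y hy w
    have h1 := ThetaV_apply_eq_add L Y (φ.symm y)
      (mfderiv 𝓘(ℝ, PhaseCoords n) (phaseModel n) φ.symm y w)
    rw [dt_extChartAt_symm hy] at h1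
    simp only [α, MForm.inChart_eq_pullback]
    exact eq_sub_of_add_eq h1.symm
  -- `extDeriv_apply_of_eventually` needs the differentiability of the form itself.
  have hΘ : DifferentiableAt ℝ (MForm.inChart (phaseModel n) (Theta L) x) (φ x) := by
    let A : PhaseCoords n → PhaseCoords n →L[ℝ] ℝ := fun y =>
      (ContinuousAlternatingMap.ofSubsingletonLIE (𝕜 := ℝ) (E := PhaseCoords n) (F := ℝ)
        (0 : Fin 1)).symm (α y) - ε y • ContinuousLinearMap.snd ℝ (Config n × Config n) ℝ
    have hA : ContDiffAt ℝ ∞ A (φ x) :=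
      ((ContinuousAlternatingMap.ofSubsingletonLIE (𝕜 := ℝ) (E := PhaseCoords n) (F := ℝ)
        (0 : Fin 1)).symm.contDiff.contDiffAt.comp _ hα).sub (hε.smul contDiffAt_const)
    exact (hA.alternating_of_eventually (heq.mono fun y hy w => hy w)).differentiableAt (by simp)
  have hd : ∀ w v : PhaseCoords n, fderiv ℝ (fun y => α y (fun _ => w) - ε y * w.2) (φ x) v =
      fderiv ℝ (fun y => α y (fun _ => w)) (φ x) v - differential (energy L Y) x v * dt x w := by
    intro w v
    have h1 : DifferentiableAt ℝ (fun y => α y (fun _ => w)) (φ x) :=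
      (hα.differentiableAt (by simp)).continuousAlternatingMap_apply_const _
    rw [fderiv_fun_sub h1 ((hε.differentiableAt (by simp)).mul_const _),
      fderiv_mul_const (hε.differentiableAt (by simp)), dt_eq,
      differential_eq_fderiv x (hE.mdifferentiableAt (by simp))]
    simp only [sub_apply, smul_apply, smul_eq_mul]
    ring
  rw [MForm.extDer_eq_extDeriv_inChart, MForm.extDer_eq_extDeriv_inChart]
  refine (extDeriv_apply_of_eventually hΘ heq a b).trans ?_
  refine (congrArg₂ (· - ·) (hd b a) (hd a b)).trans ?_
  have h2 := extDeriv_apply_of_eventually (hα.differentiableAt (by simp))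
    (Filter.Eventually.of_forall fun y w => rfl) a b
  refine Eq.trans ?_ (congrArg (fun r : ℝ => r - _) h2.symm)
  ring

theorem contract_Omega_apply (x : Phase n Q) (a b : TangentSpace (phaseModel n) x) :
    MForm.contract (phaseModel n) a (Omega L x) (fun _ => b) =
      -MForm.extDer (phaseModel n) (Theta L) x ![a, b] := by
  have e : Matrix.vecCons a (fun _ : Fin 1 => b) = ![a, b] := by
    funext i
    fin_cases i <;> rfl
  exact congrArg (Omega L x) e

/-- For an infinitesimal symmetry, `Ω_L^V = -dΘ_L^V`. -/
theorem OmegaV_eq (hL : ContMDiff (phaseModel n) 𝓘(ℝ, ℝ) ∞ L) (hY : SmoothAlong Y)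
    (hs : IsInfSymmetry L Y) (x : Phase n Q) :
    OmegaV L Y x = -MForm.extDer (phaseModel n) (ThetaV L Y) x := by
  ext v
  obtain ⟨a, b, rfl⟩ : ∃ a b, v = ![a, b] := ⟨v 0, v 1, by funext i; fin_cases i <;> rfl⟩
  have h1 : OmegaH L Y x ![a, b] =
      -(dt x a * MForm.extDer (phaseModel n) (Theta L) x ![jetLift Y x, b]) +
        dt x b * MForm.extDer (phaseModel n) (Theta L) x ![jetLift Y x, a] := by
    refine (MForm.wedge_apply _ _ _).trans ?_
    rw [Fin.sum_univ_two, Fin.removeNth_zero_pair, Fin.removeNth_one_pair, contract_Omega_apply,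
      contract_Omega_apply]
    simp
  have h2 : OmegaV L Y x ![a, b] =
      -MForm.extDer (phaseModel n) (Theta L) x ![a, b] - OmegaH L Y x ![a, b] := rfl
  have h3 : (-MForm.extDer (phaseModel n) (ThetaV L Y) x) ![a, b] =
      -(MForm.extDer (phaseModel n) (ThetaV L Y) x ![a, b]) := rfl
  rw [h2, h1, h3]
  simp only [extDer_Theta_apply hL hY, extDer_ThetaV_jetLift hL hY hs,
    differential_energy_jetLift hL hY hs, dt_jetLift]
  ring

variable [T2Space Q]

theorem energy_eq_of_proj_eq (hL : ContMDiff (phaseModel n) 𝓘(ℝ, ℝ) ∞ L) (hY : SmoothAlong Y)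
    (hs : IsInfSymmetry L Y) {x y : Phase n Q} (h : proj Y x = proj Y y) :
    energy L Y x = energy L Y y := by
  rcases eq_or_onCommonCurve hY h with rfl | ⟨γ, J, hJ, hJc, hγ, a, ha, b, hb, rfl, rfl⟩
  · rfl
  · have hd : ∀ s ∈ J, HasDerivAt (energy L Y ∘ γ) 0 s := fun s hs' =>
      (hasDerivAt_comp_integralCurve hJ hγ hs'
        ((contMDiff_energy hL hY).mdifferentiableAt (by simp))).congr_deriv
        (differential_energy_jetLift hL hY hs _)
    exact hJ.is_const_of_deriv_eq_zero hJc.isPreconnected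
      (fun s hs => (hd s hs).differentiableAt.differentiableWithinAt)
      (fun s hs => (hd s hs).deriv) ha hb

end Lagr

/-! ### Projectability -/

theorem mainTheorem2 {n m : ℕ}
    {Q : Type*} [TopologicalSpace Q] [T2Space Q]
    [ChartedSpace (EuclideanSpace ℝ (Fin n)) Q] [IsManifold (𝓡 n) ∞ Q]
    (L : Lagr.Phase n Q → ℝ) (hL : ContMDiff (Lagr.phaseModel n) 𝓘(ℝ, ℝ) ∞ L)
    (Y : ∀ z : Q × ℝ, TangentSpace (𝓡 n) z.1) (hY : Lagr.SmoothAlong Y)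
    (hsymm : Lagr.IsInfSymmetry L Y)
    [ChartedSpace (EuclideanSpace ℝ (Fin m)) (Lagr.Reduced Y)]
    [IsManifold (𝓡 m) ∞ (Lagr.Reduced Y)]
    (hproj : Manifold.IsSubmersion (Lagr.phaseModel n) (𝓡 m) ∞ (Lagr.proj Y)) :
    MForm.Projectable (Lagr.phaseModel n) (𝓡 m) (Lagr.proj Y) (Lagr.ThetaV L Y) ∧
    MForm.Projectable (Lagr.phaseModel n) (𝓡 m) (Lagr.proj Y) (Lagr.OmegaV L Y) ∧
    ∃ e : Lagr.Reduced Y → ℝ, ContMDiff (𝓡 m) 𝓘(ℝ, ℝ) ∞ e ∧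
      e ∘ Lagr.proj Y = Lagr.energy L Y := by
  have hsub : ∀ x, Nonempty
      (SubmersionCharts (Lagr.phaseModel n) (𝓡 m) hproj.complement (Lagr.proj Y) x) :=
    fun x => (hproj.isSubmersionOfComplement_complement x).nonempty_submersionCharts
  have hsurj : Function.Surjective (Lagr.proj Y) := Quotient.mk_surjective
  have hsmooth : ContMDiff (Lagr.phaseModel n) (𝓡 m) ∞ (Lagr.proj Y) := hproj.contMDiff
  have hdiff := fun x => (hsmooth x).mdifferentiableAt (by simp)
  -- The kernel of the derivative of the projection is spanned by `j¹Ỹ`.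
  have hker : ∀ (x : Lagr.Phase n Q) (a : TangentSpace (Lagr.phaseModel n) x),
      (mfderiv (Lagr.phaseModel n) (𝓡 m) (Lagr.proj Y) x a : EuclideanSpace ℝ (Fin m)) = 0 →
      ∃ r : ℝ, a = r • Lagr.jetLift Y x := by
    intro x a ha
    obtain ⟨c⟩ := hsub x
    exact c.exists_smul_eq continuous_snd
      (fun y z h ht => Lagr.eq_of_proj_eq_of_snd_eq hY h ht)
      (Lagr.mfderiv_proj_jetLift hY x (hdiff x)) ha (Lagr.jetLift_ne_zero x)
  have hΘ : MForm.Projectable (Lagr.phaseModel n) (𝓡 m) (Lagr.proj Y) (Lagr.ThetaV L Y) := by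
    refine MForm.projectable_of_basic hsub hsurj (Lagr.isPreconnected_fibre_proj hY)
      (Lagr.smooth_ThetaV hL hY) (fun x a ha => ?_) (fun x a b ha => ?_)
    · -- `Θ_L^V` vanishes on `j¹Ỹ`, because `j¹Ỹ` projects to `Y` and `dt (j¹Ỹ) = 1`.
      obtain ⟨r, rfl⟩ := hker x a ha
      rw [Lagr.ThetaV_apply, map_smul, map_smul, Lagr.mfderiv_base_jetLift, Lagr.dt_jetLift,
        smul_eq_mul, mul_one, sub_self, map_zero, map_zero]
    · obtain ⟨r, rfl⟩ := hker x a ha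
      have h1 := (MForm.extDer (Lagr.phaseModel n) (Lagr.ThetaV L Y) x).map_update_smul
        ![Lagr.jetLift Y x, b] 0 r (Lagr.jetLift Y x)
      simp only [Matrix.vecCons, Fin.update_cons_zero] at h1
      exact h1.trans ((congrArg (r • ·) (Lagr.extDer_ThetaV_jetLift hL hY hsymm x b)).trans
        (smul_zero r))
  refine ⟨hΘ, ?_, ?_⟩
  · obtain ⟨θ, hθ, hpull⟩ := hΘ
    refine ⟨fun p => -MForm.extDer (𝓡 m) θ p, hθ.extDer.neg, ?_⟩
    funext x
    have h1 := MForm.extDer_pullback hθ (hsmooth x)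
    rw [hpull] at h1
    rw [Lagr.OmegaV_eq hL hY hsymm, h1]
    rfl
  · refine ⟨Quotient.lift (Lagr.energy L Y) fun x y h =>
      Lagr.energy_eq_of_proj_eq hL hY hsymm (Quotient.sound h), ?_, rfl⟩
    exact contMDiff_of_comp_submersion hsub hsurj (Lagr.contMDiff_energy hL hY)

end
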